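/- For integers $0\le n\le u$ write $\mathcal B(n,u)=\lceil \log_2\binom{u}{n}\rceil$ and $[m]=\{0,\dots,m-1\}$. The computation model is the word RAM with word size $w$ bits, where only $m+n<2^w$ is assumed (so in particular $w=\Theta(\lg(m+n))$ is allowed): a data structure is a string of bits, stored in read-only memory in consecutive $w$-bit words; a query algorithm is a fixed program, independent of $n,m,w$ and of the data, which starts with $n$, $m$, $w$ and the query argument in registers and performs in unit time: arithmetic modulo $2^w$ (addition, subtraction, multiplication), integer division, bitwise logic, shifts, most significant bit, comparisons with jumps, loading of constants, copying of registers, and reading of a memory word. 1. (Prefix sums.) There are a program, a constant $T$ and a function $g(n)=o(n)$ such that for all integers $n,m\ge 0$ and every $w$ with $m+n<2^w$, every sequence $X=x_1,\dots,x_n$ of non-negative integers with $\sum_{j=1}^n x_j\le m$ (in particular every such sequence of sum exactly $m$) can be represented by a string of at most $\mathcal B(n,m+n)+g(n)$ bits (its length depending only on $n$, $m$, $w$) from which the program answers every query $\mathrm{Sum}(i,X)=\sum_{j=1}^i x_j$, $1\le i\le n$, in at most $T$ steps. 2. (Multisets.) Likewise there are a program, a constant $T$ and a function $g(n)=o(n)$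 such that for all $n,m\ge 0$ and every $w$ with $m+n<2^w$, every multiset $M$ of $n$ elements (counted with multiplicity) from $[m]$ can be represented by a string of at most $\mathcal B(n,m+n)+g(n)$ bits (its length depending only on $n$, $m$, $w$) from which the program answers every query $\mathrm{Selectm}(i,M)$, $1\le i\le n$, in at most $T$ steps. Here $\mathrm{Selectm}(i,M)$ is the largest $x\in M$ with $\mathrm{Rankm}(x,M)\le i-1$, where $\mathrm{Rankm}(x,M)=|\{y\in M: y<x\}|$ (with multiplicity) for $x\in M$ and $\mathrm{Rankm}(x,M)=-1$ for $x\notin M$. 3. (Optimality.) For all $n,m\ge 0$, $\mathcal B(n,m+n)$ is the information-theoretic minimum for the sequences in 1: it is the least $L$ such that the sequences of $n$ non-negative integers with sum at most $m$ can be mapped injectively to strings of $L$ bits. Moreover, if the multisets of $n$ elements from $[m]$ can be mapped injectively to strings of $L$ bits, then $L\ge \mathcal B(n,m+n)-\lceil\log_2(n+1)\rceil$, so that the space bound in 2 is within $o(n)$ bits of optimal; and if $n\ge 1$ and the sequences of $n$ non-negative integers with sum exactly $m$ can be mapped injectively to strings of $L$ bits, then $L\ge \mathcal B(n,m+n)-\lceil\log_2\frac{m+n}{n}\rceil$.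 -/

import Mathlib

namespace Succinct

/-! ### The word RAM

A machine with word size `w`: registers hold words, i.e. naturals below `2 ^ w`, and the static data
structure is a read-only memory of `w`-bit words, addressed by words. Every instruction costs one
step. A program is a fixed finite list of instructions, independent of `w` and of the input. -/

/-- Two-operand word instructions: arithmetic modulo `2 ^ w`, integer division, bitwise logic and
shifts by a variable amount. -/
inductive BinOp
  | add | sub | mul | div | and | or | xor | shl | shr

/-- The effect of a two-operand instruction on words `x, y < 2 ^ w` (with `x / 0 = 0`). -/
def BinOp.eval (w : ℕ) : BinOp → ℕ → ℕ → ℕ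
  | .add, x, y => (x + y) % 2 ^ w
  | .sub, x, y => (x + (2 ^ w - y)) % 2 ^ w
  | .mul, x, y => (x * y) % 2 ^ w
  | .div, x, y => x / y
  | .and, x, y => x &&& y
  | .or, x, y => x ||| y
  | .xor, x, y => x ^^^ y
  | .shl, x, y => (x * 2 ^ y) % 2 ^ w
  | .shr, x, y => x / 2 ^ y

/-- Instructions. Registers and jump targets are natural numbers; `d` is the destination register.
`msb` is the index of the most significant set bit, `⌊lg x⌋` (and `0` for `x = 0`), which the word
RAM literature evaluates in constant time. -/
inductive Instr
  /-- `R[d] := k mod 2 ^ w` -/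
  | const (d k : ℕ)
  /-- `R[d] := R[a]` -/
  | move (d a : ℕ)
  /-- `R[d] := R[a] op R[b]` -/
  | bin (op : BinOp) (d a b : ℕ)
  /-- `R[d] := ⌊lg R[a]⌋` -/
  | msb (d a : ℕ)
  /-- `R[d] := MEM[R[a]]` -/
  | load (d a : ℕ)
  /-- if `R[a] < R[b]` go to instruction `t` -/
  | jlt (a b t : ℕ)
  /-- if `R[a] = R[b]` go to instruction `t` -/
  | jeq (a b t : ℕ)
  /-- stop -/
  | halt

/-- A program; execution starts at instruction `0`. -/
abbrev Program := List Instr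

/-- A configuration: program counter and register contents. -/
structure Config where
  pc : ℕ
  reg : ℕ → ℕ

/-- Write `v` to register `d` and go on to the next instruction. -/
def Config.write (c : Config) (d v : ℕ) : Config :=
  ⟨c.pc + 1, Function.update c.reg d v⟩

/-- Go to instruction `t` if `p` holds, and to the next instruction otherwise. -/
def Config.jump (c : Config) (p : Prop) [Decidable p] (t : ℕ) : Config :=
  ⟨if p then t else c.pc + 1, c.reg⟩

/-- The effect of one instruction on a machine with word size `w` and memory `mem`. -/
def Instr.exec (w : ℕ) (mem : ℕ → ℕ) (c : Config) : Instr → Config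
  | .const d k => c.write d (k % 2 ^ w)
  | .move d a => c.write d (c.reg a)
  | .bin op d a b => c.write d (op.eval w (c.reg a) (c.reg b))
  | .msb d a => c.write d (Nat.log 2 (c.reg a))
  | .load d a => c.write d (mem (c.reg a))
  | .jlt a b t => c.jump (c.reg a < c.reg b) t
  | .jeq a b t => c.jump (c.reg a = c.reg b) t
  | .halt => c

/-- The instruction to be executed next; leaving the program means `halt`. -/
def Program.fetch (P : Program) (c : Config) : Instr := P.getD c.pc .halt

/-- One step. A halted configuration is left unchanged. -/
def Program.step (P : Program) (w : ℕ) (mem : ℕ → ℕ) (c : Config) : Config :=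
  (P.fetch c).exec w mem c

/-- `S` bits stored in consecutive words of `w` bits, the last one padded with zeros: word number
`a` holds the bits at positions `a * w, …, a * w + w - 1` (and is `0` past the end). -/
def memory (w : ℕ) {S : ℕ} (bits : BitVec S) (a : ℕ) : ℕ :=
  bits.toNat / 2 ^ (a * w) % 2 ^ w

/-- The initial configuration of a query with argument `i`: registers `0, 1, 2, 3` hold
`n, m, w, i` and all the others hold `0`. -/
def initConfig (n m w i : ℕ) : Config :=
  ⟨0, fun r => match r with
    | 0 => n
    | 1 => m
    | 2 => w
    | 3 => i
    | _ => 0⟩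

/-- On the machine with word size `w` whose memory holds `bits`, for the parameters `n` and `m` and
the query argument `i`, the program `P` halts within `T` steps with `v` in register `0`. -/
def Answers (P : Program) (T n m w : ℕ) {S : ℕ} (bits : BitVec S) (i v : ℕ) : Prop :=
  let c := (P.step w (memory w bits))^[T] (initConfig n m w i)
  P.fetch c = .halt ∧ c.reg 0 = v

/-! ### Space bounds -/

/-- `B(n, m) = ⌈lg (m choose n)⌉`. -/
noncomputable def B (n m : ℕ) : ℕ := ⌈Real.logb 2 (m.choose n : ℝ)⌉₊

/-- The members of `α` can be represented, in whatever way, by strings of `L` bits. -/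
def EncodableInBits (α : Type) (L : ℕ) : Prop :=
  ∃ f : α → BitVec L, Function.Injective f

/-! ### The queries -/

/-- `Sum(i, X) = x₁ + ⋯ + xᵢ`, where the entry `x j` of `x : Fin n → ℕ` is `x_{j+1}`. -/
def prefixSum {n : ℕ} (x : Fin n → ℕ) (i : ℕ) : ℕ :=
  ∑ j : Fin n with j.val < i, x j

/-- Multiset rank: `-1` if `x ∉ M`, and the number of `y ∈ M`, counted with multiplicity, such that
`y < x` otherwise. -/
def rankm {m : ℕ} (x : Fin m) (M : Multiset (Fin m)) : ℤ :=
  if x ∈ M then (M.countP (· < x) : ℤ) else -1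

/-- `v` is the answer of multiset select at `i`: the largest `x ∈ M` of multiset rank at most
`i - 1`. -/
def IsSelectm {m : ℕ} (i : ℕ) (M : Multiset (Fin m)) (v : Fin m) : Prop :=
  IsGreatest {x : Fin m | x ∈ M ∧ rankm x M ≤ (i : ℤ) - 1} v

end Succinct

/-! Optimality is stars and bars: there are `(m + n).choose n` bounded sums, and the counts of exact
sums and of multisets differ from it by the factors `(m + n) / n` and `(m + n) / m ≤ n + 1`.

The data structure splits off the low `l` bits of every prefix sum, with `l` chosen so that the high
parts live in a universe `u = m / 2 ^ l` below `2 * n * 2 ^ mu`, where `mu` is about `lg lg n`. If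
`l > 0`, also `n * 2 ^ mu ≤ u`, and then the split costs only `O(n / 2 ^ mu + 1)` bits
(`choose_mul_two_pow_le`). The increments of the high parts are cut into blocks of `t = mu ^ 2`, and
`s = 2 ^ mu` blocks form a superblock. A block with sum `y` is coded in `⌈lg (y + t choose t)⌉`
bits; by Vandermonde the product of these binomials is at most `(u + n choose n)`, so full blocks
lose one bit each (`two_pow_sum_codeLen_le`).

A superblock with sum above `Y = 2 ^ (4 * mu)` is long: there are at most `u / Y` of those, few
enough to store their values verbatim. In a short one, block sums and positions are numbers of
`O(mu)` bits, and the codes have `O(mu ^ 3)` bits, so a single table of `n ^ o(1)` bits decodes all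
blocks. Space is summed in `space_le`, and `mu_mul_overhead_le` shows that the redundancy is `O(n /
mu)`.

The query is one branch-free expression, compiled to straight-line code (`Ex.code_run`), which gives
the constant time bound at once. `exists_layout` describes the stored string, `eval_main` evaluates
the query on it. For word sizes up to a constant `K` only boundedly many `n` occur, and the answers
are stored one per word at a cost of `O(1)` bits. Multisets reduce to prefix sums through the gaps
of their sorted list (`exists_sequence`). -/

namespace Succinct

/-! ### Compilation of branch-free expressions. -/

/-- Branch-free expressions over the input registers `0, 1, 2, 3`. -/
inductive Ex
  | inp (r : Fin 4)
  | const (k : ℕ)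
  | bin (op : BinOp) (a b : Ex)
  | msb (a : Ex)
  | load (a : Ex)

/-- The value of an expression on the word RAM. -/
def Ex.eval (w : ℕ) (mem inp : ℕ → ℕ) : Ex → ℕ
  | .inp r => inp r
  | .const k => k % 2 ^ w
  | .bin op a b => op.eval w (a.eval w mem inp) (b.eval w mem inp)
  | .msb a => Nat.log 2 (a.eval w mem inp)
  | .load a => mem (a.eval w mem inp)

/-- Code that leaves the value of the expression in register `d` and changes no register below. -/
def Ex.code : ℕ → Ex → Program
  | d, .inp r => [.move d r]
  | d, .const k => [.const d k]
  | d, .bin op a b => a.code d ++ (b.code (d + 1) ++ [.bin op d d (d + 1)])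
  | d, .msb a => a.code d ++ [.msb d d]
  | d, .load a => a.code d ++ [.load d d]

theorem Program.fetch_append (pre post : Program) (i : Instr) (reg : ℕ → ℕ) :
    Program.fetch (pre ++ i :: post) ⟨pre.length, reg⟩ = i := by
  simp [Program.fetch]

/-- Registers from `d` on serve as a stack: evaluating the second operand at `d + 1` leaves the
first one in `d` intact. The surrounding code `pre`, `post` is arbitrary so that the induction
applies to subexpressions in place; without jumps, the number of steps is the length of the code. -/
theorem Ex.code_run (w : ℕ) (mem inp : ℕ → ℕ) (e : Ex) :
    ∀ (d : ℕ) (pre post : Program) (reg : ℕ → ℕ), 4 ≤ d → (∀ r < 4, reg r = inp r) →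
      ∃ reg' : ℕ → ℕ,
        (Program.step (pre ++ (e.code d ++ post)) w mem)^[(e.code d).length] ⟨pre.length, reg⟩ =
          ⟨pre.length + (e.code d).length, reg'⟩ ∧
        reg' d = e.eval w mem inp ∧ ∀ r < d, reg' r = reg r := by
  induction e with
  | inp r =>
    intro d pre post reg hd hr
    refine ⟨Function.update reg d (reg r), ?_, ?_, ?_⟩
    · simp only [Ex.code, List.length_singleton, Function.iterate_one, List.singleton_append,
        Program.step, Program.fetch_append]
      rfl
    · simp [Ex.eval, hr r r.2]
    · intro q hq
      simp [Function.update_of_ne hq.ne]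
  | const k =>
    intro d pre post reg hd hr
    refine ⟨Function.update reg d (k % 2 ^ w), ?_, ?_, ?_⟩
    · simp only [Ex.code, List.length_singleton, Function.iterate_one, List.singleton_append,
        Program.step, Program.fetch_append]
      rfl
    · simp [Ex.eval]
    · intro q hq
      simp [Function.update_of_ne hq.ne]
  | bin op a b iha ihb =>
    intro d pre post reg hd hr
    obtain ⟨r₁, h₁, v₁, p₁⟩ := iha d pre (b.code (d + 1) ++ (.bin op d d (d + 1) :: post)) reg hd hr
    obtain ⟨r₂, h₂, v₂, p₂⟩ := ihb (d + 1) (pre ++ a.code d) (.bin op d d (d + 1) :: post) r₁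
      (by lia) (fun r h => by rw [p₁ r (by lia), hr r h])
    refine ⟨Function.update r₂ d (op.eval w (r₂ d) (r₂ (d + 1))), ?_, ?_, ?_⟩
    · have hP : pre ++ (Ex.code d (.bin op a b) ++ post) =
          pre ++ (a.code d ++ (b.code (d + 1) ++ (.bin op d d (d + 1) :: post))) := by
        simp [Ex.code]
      have hP' : pre ++ (Ex.code d (.bin op a b) ++ post) =
          (pre ++ a.code d) ++ (b.code (d + 1) ++ (.bin op d d (d + 1) :: post)) := by
        simp [Ex.code]
      have hP'' : pre ++ (Ex.code d (.bin op a b) ++ post) =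
          (pre ++ a.code d ++ b.code (d + 1)) ++ (.bin op d d (d + 1) :: post) := by
        simp [Ex.code]
      have hlen : (Ex.code d (.bin op a b)).length =
          1 + ((b.code (d + 1)).length + (a.code d).length) := by
        simp [Ex.code]; lia
      rw [hlen, Function.iterate_add_apply, Function.iterate_add_apply, hP, h₁, ← hP, hP']
      rw [List.length_append] at h₂
      rw [h₂, ← hP', hP'', Function.iterate_one, Program.step]
      have hl : pre.length + (a.code d).length + (b.code (d + 1)).length =
          (pre ++ a.code d ++ b.code (d + 1)).length := by simp; lia
      rw [hl, Program.fetch_append, ← hl]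
      simp only [Instr.exec, Config.write, Config.mk.injEq, and_true]
      lia
    · rw [Function.update_self, v₂, p₂ d (by lia), v₁, Ex.eval]
    · intro q hq
      rw [Function.update_of_ne hq.ne, p₂ q (by lia), p₁ q hq]
  | msb a iha =>
    intro d pre post reg hd hr
    obtain ⟨r₁, h₁, v₁, p₁⟩ := iha d pre (.msb d d :: post) reg hd hr
    refine ⟨Function.update r₁ d (Nat.log 2 (r₁ d)), ?_, ?_, ?_⟩
    · have hP : pre ++ (Ex.code d (.msb a) ++ post) = pre ++ (a.code d ++ (.msb d d :: post)) := by
        simp [Ex.code]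
      have hP' : pre ++ (Ex.code d (.msb a) ++ post) = (pre ++ a.code d) ++ (.msb d d :: post) := by
        simp [Ex.code]
      have hlen : (Ex.code d (.msb a)).length = 1 + (a.code d).length := by
        simp [Ex.code]; lia
      rw [hlen, Function.iterate_add_apply, hP, h₁, ← hP, hP', Function.iterate_one, Program.step,
        ← List.length_append, Program.fetch_append, List.length_append]
      simp only [Instr.exec, Config.write, Config.mk.injEq, and_true]
      lia
    · rw [Function.update_self, v₁, Ex.eval]
    · intro q hq
      rw [Function.update_of_ne hq.ne, p₁ q hq]
  | load a iha =>
    intro d pre post reg hd hr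
    obtain ⟨r₁, h₁, v₁, p₁⟩ := iha d pre (.load d d :: post) reg hd hr
    refine ⟨Function.update r₁ d (mem (r₁ d)), ?_, ?_, ?_⟩
    · have hP : pre ++ (Ex.code d (.load a) ++ post) = pre ++ (a.code d ++ (.load d d :: post)) := by
        simp [Ex.code]
      have hP' : pre ++ (Ex.code d (.load a) ++ post) = (pre ++ a.code d) ++ (.load d d :: post) := by
        simp [Ex.code]
      have hlen : (Ex.code d (.load a)).length = 1 + (a.code d).length := by
        simp [Ex.code]; lia
      rw [hlen, Function.iterate_add_apply, hP, h₁, ← hP, hP', Function.iterate_one, Program.step,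
        ← List.length_append, Program.fetch_append, List.length_append]
      simp only [Instr.exec, Config.write, Config.mk.injEq, and_true]
      lia
    · rw [Function.update_self, v₁, Ex.eval]
    · intro q hq
      rw [Function.update_of_ne hq.ne, p₁ q hq]

/-- The program that puts the value of an expression into register `0` and stops. -/
def Ex.program (e : Ex) : Program := e.code 4 ++ [.move 0 4]

/-- The input registers of a query. -/
def inputs (n m w i : ℕ) : ℕ → ℕ := (initConfig n m w i).reg

theorem Ex.program_answers (e : Ex) (n m w i : ℕ) {S : ℕ} (bits : BitVec S) :
    Answers e.program (e.program).length n m w bits i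
      (e.eval w (memory w bits) (inputs n m w i)) := by
  obtain ⟨r₁, h₁, v₁, -⟩ := e.code_run w (memory w bits) (inputs n m w i) 4 [] [.move 0 4]
    (initConfig n m w i).reg le_rfl (fun _ _ => rfl)
  have hlen : (e.program).length = 1 + (e.code 4).length := by
    simp [Ex.program]; lia
  have key : (Program.step e.program w (memory w bits))^[(e.program).length]
      (initConfig n m w i) = ⟨(e.program).length, Function.update r₁ 0 (r₁ 4)⟩ := by
    have h₂ : (Program.step e.program w (memory w bits))^[(e.code 4).length]
        (initConfig n m w i) = ⟨(e.code 4).length, r₁⟩ := by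
      have h := h₁
      simp only [List.nil_append, List.length_nil, zero_add] at h
      exact h
    rw [hlen, Function.iterate_add_apply, h₂, Function.iterate_one, Program.step, Ex.program,
      Program.fetch_append]
    simp only [Instr.exec, Config.write, Config.mk.injEq, and_true]
    lia
  unfold Answers
  simp only [key]
  refine ⟨?_, by simp [v₁]⟩
  simp [Program.fetch]

/-! ### Evaluation of expressions and reading of bit fields. -/

/-- In the given machine state the expression has the value `v`. -/
def Ev (w : ℕ) (mem inp : ℕ → ℕ) (e : Ex) (v : ℕ) : Prop := e.eval w mem inp = v

namespace Ex

def add (a b : Ex) : Ex := .bin .add a b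
def sub (a b : Ex) : Ex := .bin .sub a b
def mul (a b : Ex) : Ex := .bin .mul a b
def div (a b : Ex) : Ex := .bin .div a b
def shl (a b : Ex) : Ex := .bin .shl a b
def shr (a b : Ex) : Ex := .bin .shr a b
/-- Remainder. -/
def rem (a b : Ex) : Ex := sub a (mul (div a b) b)
/-- The lowest `f` bits of `a`. -/
def low (a f : Ex) : Ex := sub a (shl (shr a f) f)
/-- The `w` bits of memory from bit `r` of word `a` on, where `r < w`. -/
def window (a r : Ex) : Ex :=
  add (shr (load a) r) (shl (load (add a (const 1))) (sub (inp 2) r))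
/-- The field of `f` bits of memory that starts `r` bits after the beginning of word `a`. -/
def field (a r f : Ex) : Ex :=
  low (window (add a (div r (inp 2))) (rem r (inp 2))) f

end Ex

section
variable {w : ℕ} {mem inp : ℕ → ℕ} {a b c : Ex} {x y z : ℕ}

theorem Ev.lit {k : ℕ} (hk : k < 2 ^ w) : Ev w mem inp (.const k) k := Nat.mod_eq_of_lt hk

theorem Ev.add (ha : Ev w mem inp a x) (hb : Ev w mem inp b y) (h : x + y < 2 ^ w) :
    Ev w mem inp (a.add b) (x + y) := by
  unfold Ev at *
  simp [Ex.add, Ex.eval, BinOp.eval, ha, hb, Nat.mod_eq_of_lt h]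

theorem Ev.sub (ha : Ev w mem inp a x) (hb : Ev w mem inp b y) (h : y ≤ x) (hx : x < 2 ^ w) :
    Ev w mem inp (a.sub b) (x - y) := by
  unfold Ev at *
  simp only [Ex.sub, Ex.eval, BinOp.eval, ha, hb]
  rw [show x + (2 ^ w - y) = x - y + 2 ^ w by lia, Nat.add_mod_right, Nat.mod_eq_of_lt (by lia)]

theorem Ev.mul (ha : Ev w mem inp a x) (hb : Ev w mem inp b y) (h : x * y < 2 ^ w) :
    Ev w mem inp (a.mul b) (x * y) := by
  unfold Ev at *
  simp [Ex.mul, Ex.eval, BinOp.eval, ha, hb, Nat.mod_eq_of_lt h]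

/-- Nothing is assumed about `b`. This is what replaces branching: the alternative that does not
apply is evaluated on meaningless data and then multiplied by zero. -/
theorem Ev.zero_mul (ha : Ev w mem inp a 0) (b : Ex) : Ev w mem inp (a.mul b) 0 := by
  unfold Ev at *
  simp [Ex.mul, Ex.eval, BinOp.eval, ha]

theorem Ev.div (ha : Ev w mem inp a x) (hb : Ev w mem inp b y) :
    Ev w mem inp (a.div b) (x / y) := by
  unfold Ev at *
  simp [Ex.div, Ex.eval, BinOp.eval, ha, hb]

theorem Ev.shl (ha : Ev w mem inp a x) (hb : Ev w mem inp b y) (h : x * 2 ^ y < 2 ^ w) :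
    Ev w mem inp (a.shl b) (x * 2 ^ y) := by
  unfold Ev at *
  simp [Ex.shl, Ex.eval, BinOp.eval, ha, hb, Nat.mod_eq_of_lt h]

theorem Ev.shr (ha : Ev w mem inp a x) (hb : Ev w mem inp b y) :
    Ev w mem inp (a.shr b) (x / 2 ^ y) := by
  unfold Ev at *
  simp [Ex.shr, Ex.eval, BinOp.eval, ha, hb]

theorem Ev.msb (ha : Ev w mem inp a x) : Ev w mem inp a.msb (Nat.log 2 x) := by
  unfold Ev at *
  simp [Ex.eval, ha]

theorem Ev.load (ha : Ev w mem inp a x) : Ev w mem inp a.load (mem x) := by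
  unfold Ev at *
  simp [Ex.eval, ha]

theorem Ev.rem (ha : Ev w mem inp a x) (hb : Ev w mem inp b y) (hx : x < 2 ^ w) :
    Ev w mem inp (a.rem b) (x % y) := by
  have h := Nat.div_mul_le_self x y
  have := ha.sub ((ha.div hb).mul hb (h.trans_lt hx)) h hx
  rwa [Nat.mul_comm, ← Nat.mod_eq_sub_mul_div] at this

theorem Ev.low (ha : Ev w mem inp a x) (hb : Ev w mem inp b y) (hx : x < 2 ^ w) :
    Ev w mem inp (a.low b) (x % 2 ^ y) := by
  have h := Nat.div_mul_le_self x (2 ^ y)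
  have := ha.sub ((ha.shr hb).shl hb (h.trans_lt hx)) h hx
  rwa [Nat.mul_comm, ← Nat.mod_eq_sub_mul_div] at this

end

/-- Two adjacent words contain every window of `w` bits that starts in the first. -/
theorem window_eq (Z : ℕ) {w r : ℕ} (hr : r ≤ w) :
    Z % 2 ^ w / 2 ^ r + (Z / 2 ^ w % 2 ^ w * 2 ^ (w - r)) % 2 ^ w = Z / 2 ^ r % 2 ^ w := by
  obtain ⟨s, rfl⟩ := Nat.exists_eq_add_of_le hr
  rw [Nat.add_sub_cancel_left]
  have h1 : Z % 2 ^ (r + s) / 2 ^ r = Z / 2 ^ r % 2 ^ s := by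
    rw [pow_add, Nat.mod_mul_right_div_self]
  have h2 : (Z / 2 ^ (r + s) % 2 ^ (r + s) * 2 ^ s) % 2 ^ (r + s) =
      2 ^ s * (Z / 2 ^ r / 2 ^ s % 2 ^ r) := by
    rw [Nat.div_div_eq_div_mul, ← pow_add, Nat.mod_mul_mod, mul_comm _ (2 ^ s),
      show (2 : ℕ) ^ (r + s) = 2 ^ s * 2 ^ r by rw [pow_add, mul_comm], Nat.mul_mod_mul_left]
  rw [h1, h2, show (2 : ℕ) ^ (r + s) = 2 ^ s * 2 ^ r by rw [pow_add, mul_comm], Nat.mod_mul]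

/-- Reading a field of memory. -/
theorem Ev.field {w X : ℕ} {inp : ℕ → ℕ} {a r f : Ex} {A R F p v : ℕ}
    {mem : ℕ → ℕ} (hmem : ∀ k, mem k = X / 2 ^ (k * w) % 2 ^ w) (hw : inp 2 = w) (hw0 : 0 < w)
    (ha : Ev w mem inp a A) (hr : Ev w mem inp r R) (hf : Ev w mem inp f F)
    (hR : R < 2 ^ w) (hA : A + R / w + 1 < 2 ^ w) (hp : A * w + R = p)
    (hv : X / 2 ^ p % 2 ^ F = v) (hvw : v < 2 ^ w) :
    Ev w mem inp (a.field r f) v := by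
  have hW : Ev w mem inp (.inp 2) w := hw
  have hrw : R % w < w := Nat.mod_lt _ hw0
  have hww : w < 2 ^ w := Nat.lt_two_pow_self
  have e1 := ha.add (hr.div hW) (by lia)
  have e2 := hr.rem hW hR
  have e3 := (e1.add (Ev.lit (k := 1) (Nat.one_lt_two_pow hw0.ne')) hA).load
  have e4 : Ev w mem inp (Ex.window (a.add (r.div (.inp 2))) (r.rem (.inp 2)))
      (X / 2 ^ p % 2 ^ w) := by
    have hval := window_eq (X / 2 ^ ((A + R / w) * w)) hrw.le
    have hpos : (A + R / w) * w + R % w = p := by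
      rw [← hp, add_mul, add_assoc, Nat.div_add_mod']
    rw [Nat.div_div_eq_div_mul, Nat.div_div_eq_div_mul, ← pow_add, ← pow_add, hpos,
      ← Nat.succ_mul] at hval
    -- The overflow of this shift is intended, since it discards the bits beyond the window; hence
    -- `Ev.shl` does not apply.
    have hs : Ev w mem inp (Ex.shl (.load ((a.add (r.div (.inp 2))).add (.const 1)))
        (Ex.sub (.inp 2) (r.rem (.inp 2))))
        (mem (A + R / w + 1) * 2 ^ (w - R % w) % 2 ^ w) := by
      have e5 := hW.sub e2 hrw.le hww
      unfold Ev at e3 e5 ⊢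
      simp only [Ex.shl, Ex.eval, BinOp.eval] at e3 e5 ⊢
      rw [e3, e5]
    have := (e1.load.shr e2).add hs (by
      rw [hmem, hmem, hval]; exact Nat.mod_lt _ (by positivity))
    rwa [hmem, hmem, hval] at this
  have e6 := e4.low hf (Nat.mod_lt _ (by positivity))
  suffices h : X / 2 ^ p % 2 ^ w % 2 ^ F = v by
    rwa [h] at e6
  -- A field wider than a word is harmless when its value fits in a word: the window already
  -- determines it.
  rcases le_total F w with h | h
  · rw [Nat.mod_mod_of_dvd _ (pow_dvd_pow 2 h), hv]
  · have : X / 2 ^ p % 2 ^ w = v := by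
      rw [← Nat.mod_mod_of_dvd _ (pow_dvd_pow 2 h), hv, Nat.mod_eq_of_lt hvw]
    rw [this, Nat.mod_eq_of_lt (hvw.trans_le (Nat.pow_le_pow_right two_pos h))]

/-! ### Counting and the information-theoretic lower bounds. -/

/-- A bounded sum is an exact sum with one more summand. -/
def boundedSumEquiv (n m : ℕ) :
    {x : Fin n → ℕ // ∑ j, x j ≤ m} ≃ {x : Fin (n + 1) → ℕ // ∑ j, x j = m} where
  toFun x := ⟨Fin.cons (m - ∑ j, x.1 j) x.1, by
    have := x.2
    rw [Fin.sum_cons]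
    lia⟩
  invFun x := ⟨Fin.tail x.1, by
    have := x.2
    rw [Fin.sum_univ_succ] at this
    simp only [Fin.tail]
    lia⟩
  left_inv x := by simp
  right_inv x := by
    have := x.2
    rw [Fin.sum_univ_succ] at this
    apply Subtype.ext
    have h : m - ∑ j, Fin.tail x.1 j = x.1 0 := by
      simp only [Fin.tail]
      lia
    simp only [h, Fin.cons_self_tail]

instance (n m : ℕ) : Finite {x : Fin n → ℕ // ∑ j, x j = m} :=
  Finite.of_equiv _ (Sym.equivNatSumOfFintype (Fin n) m)

instance (n m : ℕ) : Finite {x : Fin n → ℕ // ∑ j, x j ≤ m} :=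
  Finite.of_equiv _ (boundedSumEquiv n m).symm

theorem card_exact_sum (n m : ℕ) :
    Nat.card {x : Fin n → ℕ // ∑ j, x j = m} = (n + m - 1).choose m := by
  rw [← Nat.card_congr (Sym.equivNatSumOfFintype (Fin n) m), Nat.card_eq_fintype_card,
    Sym.card_sym_eq_choose, Fintype.card_fin]

theorem card_bounded_sum (n m : ℕ) :
    Nat.card {x : Fin n → ℕ // ∑ j, x j ≤ m} = (m + n).choose n := by
  rw [Nat.card_congr (boundedSumEquiv n m), card_exact_sum, show n + 1 + m - 1 = m + n by lia,
    Nat.choose_symm_add]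

theorem encodableInBits_iff {α : Type} [Finite α] {L : ℕ} :
    EncodableInBits α L ↔ Nat.card α ≤ 2 ^ L := by
  have e : BitVec L ≃ Fin (2 ^ L) := ⟨BitVec.toFin, BitVec.ofFin, fun _ => rfl, fun _ => rfl⟩
  have := Fintype.ofFinite α
  rw [Nat.card_eq_fintype_card]
  constructor
  · rintro ⟨f, hf⟩
    simpa using Fintype.card_le_of_injective _ (e.injective.comp hf)
  · intro h
    obtain ⟨f⟩ := Function.Embedding.nonempty_of_card_le (α := α) (β := Fin (2 ^ L)) (by simpa)
    exact ⟨e.symm ∘ f, e.symm.injective.comp f.injective⟩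

theorem le_two_pow_ceil_logb {x : ℝ} (hx : 0 < x) : x ≤ 2 ^ ⌈Real.logb 2 x⌉₊ := by
  have h := Nat.le_ceil (Real.logb 2 x)
  rwa [Real.logb_le_iff_le_rpow one_lt_two hx, Real.rpow_natCast] at h

theorem B_le_iff {n u L : ℕ} (h : n ≤ u) : B n u ≤ L ↔ u.choose n ≤ 2 ^ L := by
  have hc : (0 : ℝ) < u.choose n := by exact_mod_cast Nat.choose_pos h
  rw [B, Nat.ceil_le, Real.logb_le_iff_le_rpow one_lt_two hc, Real.rpow_natCast]
  exact_mod_cast Iff.rfl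

theorem choose_le_two_pow_B {n u : ℕ} (h : n ≤ u) : u.choose n ≤ 2 ^ B n u :=
  (B_le_iff h).1 le_rfl

theorem isLeast_encodable_bounded_sum (n m : ℕ) :
    IsLeast {L : ℕ | EncodableInBits {x : Fin n → ℕ // ∑ j, x j ≤ m} L} (B n (m + n)) := by
  constructor
  · rw [Set.mem_ofPred_eq, encodableInBits_iff, card_bounded_sum]
    exact choose_le_two_pow_B (by lia)
  · intro L hL
    rw [Set.mem_ofPred_eq, encodableInBits_iff, card_bounded_sum] at hL
    exact (B_le_iff (by lia)).2 hL

/-- The ratio of `(m + n).choose n` to the number of exact sums is `(m + n) / n`. -/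
theorem B_le_of_encodable_exact_sum {n m L : ℕ}
    (h : EncodableInBits {x : Fin n → ℕ // ∑ j, x j = m} L) :
    B n (m + n) ≤ L + ⌈Real.logb 2 (((m : ℝ) + n) / n)⌉₊ := by
  rw [encodableInBits_iff, card_exact_sum] at h
  rw [B_le_iff (by lia)]
  rcases n with _ | k
  · simpa using Nat.one_le_two_pow
  rw [show k + 1 + m - 1 = m + k by lia, Nat.choose_symm_add] at h
  have h1 : ((m + k).choose k : ℝ) ≤ 2 ^ L := by exact_mod_cast h
  have h2 : ((m + (k + 1)).choose (k + 1) : ℝ) * (k + 1) = (m + k + 1) * (m + k).choose k := by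
    exact_mod_cast (Nat.add_one_mul_choose_eq (m + k) k).symm
  have h3 := le_two_pow_ceil_logb (x := ((m : ℝ) + (k + 1 : ℕ)) / (k + 1 : ℕ)) (by positivity)
  have : ((m + (k + 1)).choose (k + 1) : ℝ) ≤
      2 ^ (L + ⌈Real.logb 2 (((m : ℝ) + (k + 1 : ℕ)) / (k + 1 : ℕ))⌉₊) := by
    rw [pow_add]
    calc ((m + (k + 1)).choose (k + 1) : ℝ)
        = (m + k).choose k * (((m : ℝ) + (k + 1 : ℕ)) / (k + 1 : ℕ)) := by
          push_cast
          field_simp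
          linarith
      _ ≤ _ := by gcongr
  exact_mod_cast this

/-- The ratio of `(m + n).choose n` to the number of multisets is `(m + n) / m`, which is at most `n
+ 1` for `m ≥ 1`. -/
theorem B_le_of_encodable_multiset {n m L : ℕ}
    (h : EncodableInBits {M : Multiset (Fin m) // M.card = n} L) :
    B n (m + n) ≤ L + ⌈Real.logb 2 ((n : ℝ) + 1)⌉₊ := by
  have hcard : Nat.card {M : Multiset (Fin m) // M.card = n} = (m + n - 1).choose n := by
    change Nat.card (Sym (Fin m) n) = _
    rw [Nat.card_eq_fintype_card, Sym.card_sym_eq_choose, Fintype.card_fin]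
  have : Finite {M : Multiset (Fin m) // M.card = n} := inferInstanceAs (Finite (Sym (Fin m) n))
  rw [encodableInBits_iff, hcard] at h
  rw [B_le_iff (by lia)]
  rcases m with _ | k
  · simpa using Nat.one_le_two_pow
  rw [show k + 1 + n - 1 = n + k by lia, Nat.choose_symm_add] at h
  have h1 : ((n + k).choose k : ℝ) ≤ 2 ^ L := by exact_mod_cast h
  have h2 : ((n + (k + 1)).choose (k + 1) : ℝ) * (k + 1) = (n + k + 1) * (n + k).choose k := by
    exact_mod_cast (Nat.add_one_mul_choose_eq (n + k) k).symm
  have h3 := le_two_pow_ceil_logb (x := (n : ℝ) + 1) (by positivity)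
  rw [add_comm (k + 1) n, Nat.choose_symm_add]
  have : ((n + (k + 1)).choose (k + 1) : ℝ) ≤ 2 ^ (L + ⌈Real.logb 2 ((n : ℝ) + 1)⌉₊) := by
    rw [pow_add]
    refine le_of_mul_le_mul_right (a := (k + 1 : ℝ)) ?_ (by positivity)
    calc ((n + (k + 1)).choose (k + 1) : ℝ) * (k + 1)
        = (n + k + 1) * (n + k).choose k := h2
      _ ≤ ((n + 1) * (k + 1)) * (n + k).choose k := by
          gcongr
          nlinarith [mul_nonneg n.cast_nonneg k.cast_nonneg (α := ℝ)]
      _ = (n + k).choose k * (n + 1) * (k + 1) := by ring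
      _ ≤ _ := by gcongr
  exact_mod_cast this

/-! ### Binomial estimates -/

/-- The left side is one term of Vandermonde's convolution. -/
theorem choose_mul_choose_le (a b i j : ℕ) :
    a.choose i * b.choose j ≤ (a + b).choose (i + j) := by
  rw [Nat.add_choose_eq]
  exact Finset.single_le_sum (f := fun ij : ℕ × ℕ => a.choose ij.1 * b.choose ij.2)
    (fun _ _ => Nat.zero_le _) (a := (i, j)) (by simp)

theorem prod_choose_le (t : ℕ) (y : ℕ → ℕ) (q : ℕ) :
    ∏ k ∈ Finset.range q, (y k + t).choose t ≤
      (∑ k ∈ Finset.range q, y k + q * t).choose (q * t) := by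
  induction q with
  | zero => simp
  | succ q ih =>
    rw [Finset.prod_range_succ, Finset.sum_range_succ]
    refine (Nat.mul_le_mul_right _ ih).trans ((choose_mul_choose_le _ _ _ _).trans_eq ?_)
    congr 1 <;> ring

theorem add_choose_mono {a b c d : ℕ} (h : a ≤ b) (h' : c ≤ d) :
    (a + c).choose c ≤ (b + d).choose d := by
  calc (a + c).choose c = (a + c).choose a := (Nat.choose_symm_add).symm
    _ ≤ (a + d).choose a := Nat.choose_le_choose _ (by lia)
    _ = (a + d).choose d := Nat.choose_symm_add
    _ ≤ _ := Nat.choose_le_choose _ (by lia)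

theorem add_choose_le_pow (y t : ℕ) : (y + t).choose t ≤ (y + 1) ^ t := by
  induction t with
  | zero => simp
  | succ t ih =>
    have h := Nat.add_one_mul_choose_eq (y + t) t
    rw [pow_succ]
    refine le_of_mul_le_mul_right (a := t + 1) ?_ t.succ_pos
    calc (y + (t + 1)).choose (t + 1) * (t + 1) = (y + t + 1) * (y + t).choose t := h.symm
      _ ≤ ((y + 1) * (t + 1)) * (y + 1) ^ t := Nat.mul_le_mul (by nlinarith) ih
      _ = _ := by ring

theorem two_pow_clog_le {c : ℕ} (hc : 0 < c) : 2 ^ Nat.clog 2 c ≤ 2 * c := by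
  rcases Nat.lt_or_ge 1 c with h | h
  · have h1 := Nat.pow_pred_clog_lt_self one_lt_two h
    have h2 : Nat.clog 2 c ≠ 0 := (Nat.clog_pos one_lt_two h).ne'
    obtain ⟨k, hk⟩ := Nat.exists_eq_succ_of_ne_zero h2
    rw [hk] at h1 ⊢
    rw [Nat.pred_succ] at h1
    rw [pow_succ]
    lia
  · rw [show c = 1 by lia]
    simp

/-- The code length of a block of `t` numbers with sum at most `y`. -/
def codeLen (t y : ℕ) : ℕ := Nat.clog 2 ((y + t).choose t)

/-- Rounding costs a factor of at most 2 per block, and the binomials of the blocks merge into one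
by `prod_choose_le`. The exponentiated form avoids logarithms. -/
theorem two_pow_sum_codeLen_le (t : ℕ) (y : ℕ → ℕ) (q : ℕ) :
    2 ^ (∑ k ∈ Finset.range q, codeLen t (y k)) ≤
      2 ^ q * (∑ k ∈ Finset.range q, y k + q * t).choose (q * t) := by
  refine le_trans ?_ (Nat.mul_le_mul_left _ (prod_choose_le t y q))
  rw [← Finset.prod_pow_eq_pow_sum, ← Finset.card_range q, ← Finset.prod_const, Finset.card_range,
    ← Finset.prod_mul_distrib]
  exact Finset.prod_le_prod' fun k _ => two_pow_clog_le (Nat.choose_pos (by lia))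

theorem codeLen_le {t y a : ℕ} (h : y + 1 ≤ 2 ^ a) : codeLen t y ≤ t * a := by
  refine Nat.clog_le_of_le_pow ((add_choose_le_pow y t).trans ?_)
  rw [mul_comm, pow_mul]
  exact Nat.pow_le_pow_left h t

/-- This is `(1 + 1 / K) ^ K ≤ e ≤ 4`. -/
theorem add_one_pow_le (K : ℕ) : (K + 1) ^ K ≤ 4 * K ^ K := by
  rcases Nat.eq_zero_or_pos K with rfl | hK
  · simp
  have hK' : (0 : ℝ) < K := by exact_mod_cast hK
  have h : ((K : ℝ) + 1) ^ K ≤ 4 * K ^ K := by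
    have h1 : (1 + 1 / (K : ℝ)) ^ K ≤ 4 := by
      calc (1 + 1 / (K : ℝ)) ^ K ≤ (Real.exp (1 / K)) ^ K := by
            gcongr
            rw [add_comm]
            exact Real.add_one_le_exp _
        _ = Real.exp 1 := by
            rw [← Real.exp_nat_mul]
            congr 1
            field_simp
        _ ≤ 4 := by linarith [Real.exp_one_lt_d9]
    calc ((K : ℝ) + 1) ^ K = ((1 + 1 / (K : ℝ)) * K) ^ K := by
          congr 1
          field_simp
      _ = (1 + 1 / (K : ℝ)) ^ K * K ^ K := mul_pow _ _ _
      _ ≤ _ := by gcongr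
  exact_mod_cast h

/-- Splitting off the low `l` bits of a sparse multiset costs little. -/
theorem choose_mul_two_pow_le {n m l K : ℕ} (hK : 0 < K) (h : l = 0 ∨ n * K ≤ m / 2 ^ l) :
    (m / 2 ^ l + n).choose n * 2 ^ (n * l) ≤ 2 ^ (2 * (n / K + 1)) * (m + n).choose n := by
  rcases h with rfl | h
  · simp only [pow_zero, Nat.div_one, mul_zero, mul_one]
    exact Nat.le_mul_of_pos_left _ (by positivity)
  set u := m / 2 ^ l with hu
  have hum : u * 2 ^ l ≤ m := Nat.div_mul_le_self _ _
  -- Up to `n!` the two binomials are compared through `(u + n) ^ n` and `m ^ n`. As `n * K ≤ u`,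
  -- the quotient of `u + n` by `u` is at most `1 + 1 / K`, whose `n`-th power is at most `4 ^ (n /
  -- K + 1)`.
  have h1 : (u + n).choose n * n.factorial ≤ (u + n) ^ n := by
    rw [mul_comm, ← Nat.ascFactorial_eq_factorial_mul_choose]
    exact Nat.ascFactorial_le_pow_add u n
  have h2 : m ^ n ≤ (m + n).choose n * n.factorial := by
    rw [mul_comm, ← Nat.ascFactorial_eq_factorial_mul_choose]
    exact (Nat.pow_le_pow_left (Nat.le_succ m) n).trans (Nat.pow_succ_le_ascFactorial _ _)
  have h3 : ((u + n) * K) ^ n ≤ ((K + 1) * u) ^ n := Nat.pow_le_pow_left (by nlinarith) n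
  have h4 : (K + 1) ^ n ≤ 2 ^ (2 * (n / K + 1)) * K ^ n := by
    -- The exponent `n` is padded by `d` to a multiple of `K`.
    have hle : n ≤ K * (n / K + 1) := (Nat.lt_mul_div_succ n hK).le
    obtain ⟨d, hd⟩ := Nat.exists_eq_add_of_le hle
    have h5 := Nat.pow_le_pow_left (add_one_pow_le K) (n / K + 1)
    rw [mul_pow, ← pow_mul, ← pow_mul, hd, pow_add, pow_add, show 4 = 2 ^ 2 by rfl, ← pow_mul] at h5
    refine le_of_mul_le_mul_right (a := K ^ d) ?_ (by positivity)
    calc (K + 1) ^ n * K ^ d ≤ (K + 1) ^ n * (K + 1) ^ d := by gcongr; lia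
      _ ≤ _ := h5
      _ = _ := by ring
  refine le_of_mul_le_mul_right (a := n.factorial * K ^ n) ?_
    (Nat.mul_pos n.factorial_pos (by positivity))
  calc (u + n).choose n * 2 ^ (n * l) * (n.factorial * K ^ n)
      = ((u + n).choose n * n.factorial) * K ^ n * 2 ^ (n * l) := by ring
    _ ≤ (u + n) ^ n * K ^ n * 2 ^ (n * l) := by gcongr
    _ = ((u + n) * K) ^ n * 2 ^ (n * l) := by rw [mul_pow]
    _ ≤ ((K + 1) * u) ^ n * 2 ^ (n * l) := by gcongr
    _ = (K + 1) ^ n * (u * 2 ^ l) ^ n := by rw [mul_pow, mul_pow, ← pow_mul, mul_comm n l]; ring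
    _ ≤ (2 ^ (2 * (n / K + 1)) * K ^ n) * m ^ n := by gcongr
    _ ≤ (2 ^ (2 * (n / K + 1)) * K ^ n) * ((m + n).choose n * n.factorial) := by gcongr
    _ = _ := by ring

/-! ### Concatenation of bit fields -/

/-- Fields `v 0, v 1, …` of `len 0, len 1, …` bits, stored one after the other. -/
def pack (len v : ℕ → ℕ) : ℕ → ℕ
  | 0 => 0
  | N + 1 => pack len v N + 2 ^ (∑ k ∈ Finset.range N, len k) * v N

theorem pack_lt {len v : ℕ → ℕ} {N : ℕ} (h : ∀ k < N, v k < 2 ^ len k) :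
    pack len v N < 2 ^ (∑ k ∈ Finset.range N, len k) := by
  induction N with
  | zero => simp [pack]
  | succ N ih =>
    have h1 := ih fun k hk => h k (by lia)
    have h2 := h N (by lia)
    rw [pack, Finset.sum_range_succ, pow_add]
    nlinarith

theorem add_two_pow_mul_div (a b : ℕ) {l : ℕ} (p : ℕ) (ha : a < 2 ^ l) :
    (a + 2 ^ l * b) / 2 ^ (l + p) = b / 2 ^ p := by
  rw [pow_add, ← Nat.div_div_eq_div_mul, Nat.add_mul_div_left _ _ (by positivity),
    Nat.div_eq_of_lt ha, zero_add]

theorem mod_two_pow_div_mod (Z : ℕ) {L p f : ℕ} (h : p + f ≤ L) :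
    Z % 2 ^ L / 2 ^ p % 2 ^ f = Z / 2 ^ p % 2 ^ f := by
  obtain ⟨d, rfl⟩ := Nat.exists_eq_add_of_le h
  rw [add_assoc, pow_add, Nat.mod_mul_right_div_self, Nat.mod_mod_of_dvd _ (pow_dvd_pow 2 (by lia))]

theorem add_two_pow_mul_field (a b : ℕ) {l p f : ℕ} (h : p + f ≤ l) :
    (a + 2 ^ l * b) / 2 ^ p % 2 ^ f = a / 2 ^ p % 2 ^ f := by
  rw [← mod_two_pow_div_mod _ h, Nat.add_mul_mod_self_left, mod_two_pow_div_mod _ h]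

theorem pack_field {len v : ℕ → ℕ} {N k : ℕ} (h : ∀ k < N, v k < 2 ^ len k) (hk : k < N) :
    pack len v N / 2 ^ (∑ k ∈ Finset.range k, len k) % 2 ^ len k = v k := by
  induction N with
  | zero => lia
  | succ N ih =>
    have hlt := pack_lt (N := N) (len := len) (v := v) fun k hk => h k (by lia)
    rw [pack]
    rcases Nat.lt_succ_iff_lt_or_eq.1 hk with h' | rfl
    · rw [add_two_pow_mul_field, ih (fun k hk => h k (by lia)) h']
      rw [← Finset.sum_range_succ]
      exact Finset.sum_le_sum_of_subset (Finset.range_mono h')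
    · have := add_two_pow_mul_div (pack len v k) (v k) 0 hlt
      rw [add_zero, pow_zero, Nat.div_one] at this
      rw [this, Nat.mod_eq_of_lt (h k (by lia))]

theorem pack_subfield {len v : ℕ → ℕ} {N k p f : ℕ} (h : ∀ k < N, v k < 2 ^ len k) (hk : k < N)
    (hpf : p + f ≤ len k) :
    pack len v N / 2 ^ (∑ k ∈ Finset.range k, len k + p) % 2 ^ f = v k / 2 ^ p % 2 ^ f := by
  rw [pow_add, ← Nat.div_div_eq_div_mul, ← mod_two_pow_div_mod _ hpf, pack_field h hk]

theorem pack_const_lt {f N : ℕ} {v : ℕ → ℕ} (h : ∀ k < N, v k < 2 ^ f) :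
    pack (fun _ => f) v N < 2 ^ (N * f) := by
  simpa using pack_lt h

theorem pack_const_field {f N k : ℕ} {v : ℕ → ℕ} (h : ∀ k < N, v k < 2 ^ f) (hk : k < N) :
    pack (fun _ => f) v N / 2 ^ (k * f) % 2 ^ f = v k := by
  simpa using pack_field h hk

/-! ### Codes for blocks -/

theorem prefixSum_mono {n : ℕ} (x : Fin n → ℕ) : Monotone (prefixSum x) := fun a b h =>
  Finset.sum_le_sum_of_subset fun j hj => by
    simp only [Finset.mem_filter] at hj ⊢
    exact ⟨hj.1, hj.2.trans_le h⟩

theorem prefixSum_of_le {n : ℕ} (x : Fin n → ℕ) {i : ℕ} (h : n ≤ i) :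
    prefixSum x i = ∑ j, x j := by
  rw [prefixSum, Finset.filter_true_of_mem fun j _ => j.2.trans_le h]

theorem prefixSum_le_sum {n : ℕ} (x : Fin n → ℕ) (i : ℕ) : prefixSum x i ≤ ∑ j, x j :=
  Finset.sum_le_sum_of_subset (Finset.filter_subset _ _)

theorem prefixSum_eq_sum_range {n : ℕ} (x : ℕ → ℕ) {i : ℕ} (h : i ≤ n) :
    prefixSum (fun j : Fin n => x j) i = ∑ j ∈ Finset.range i, x j := by
  rw [prefixSum, Finset.sum_filter, Fin.sum_univ_eq_sum_range (fun j => if j < i then x j else 0) n,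
    ← Finset.sum_filter]
  congr 1
  ext j
  simp only [Finset.mem_filter, Finset.mem_range]
  lia

/-- The increments of a monotone function have its values as prefix sums. -/
theorem prefixSum_increments {f : ℕ → ℕ} (hf : Monotone f) (h0 : f 0 = 0) {n i : ℕ} (h : i ≤ n) :
    prefixSum (fun j : Fin n => f (j + 1) - f j) i = f i := by
  rw [prefixSum_eq_sum_range (fun j => f (j + 1) - f j) h, Finset.sum_range_tsub hf, h0, Nat.sub_zero]

/-- Blocks of `t` numbers with sum at most `y` can be coded in `codeLen t y` bits. -/
theorem exists_decoder (t y : ℕ) : ∃ dec : ℕ → ℕ → ℕ, (∀ z j, dec z j ≤ y) ∧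
    ∀ f : ℕ → ℕ, Monotone f → f 0 = 0 → f t ≤ y →
      ∃ z < 2 ^ codeLen t y, ∀ j ≤ t, dec z j = f j := by
  obtain ⟨enc, henc⟩ : EncodableInBits {x : Fin t → ℕ // ∑ j, x j ≤ y} (codeLen t y) := by
    rw [encodableInBits_iff, card_bounded_sum]
    exact Nat.le_pow_clog one_lt_two _
  have : Nonempty {x : Fin t → ℕ // ∑ j, x j ≤ y} := ⟨⟨0, by simp⟩⟩
  -- `invFun` turns even a `z` that codes nothing into an admissible block, so every table entry is
  -- at most `y`.
  refine ⟨fun z j => prefixSum (Function.invFun enc (BitVec.ofNat _ z)).1 j,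
    fun z j => (prefixSum_le_sum _ _).trans (Function.invFun enc (BitVec.ofNat _ z)).2, ?_⟩
  intro f hf h0 hy
  have hs : ∑ j : Fin t, (f (j + 1) - f j) ≤ y := by
    rw [← prefixSum_of_le _ le_rfl, prefixSum_increments hf h0 le_rfl]
    exact hy
  refine ⟨(enc ⟨fun j => f (j + 1) - f j, hs⟩).toNat, BitVec.isLt _, fun j hj => ?_⟩
  simp only [BitVec.ofNat_toNat, BitVec.setWidth_eq, Function.leftInverse_invFun henc _]
  exact prefixSum_increments hf h0 hj

/-- The sum of the block number `k` of `t` increments of `G`. -/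
def blockSum (t : ℕ) (G : ℕ → ℕ) (k : ℕ) : ℕ := G (t * (k + 1)) - G (t * k)

/-- The superblock number `b`, of `s` blocks, has sum at most `Y`. -/
def IsShort (t s Y : ℕ) (G : ℕ → ℕ) (b : ℕ) : Prop := G (t * s * (b + 1)) - G (t * s * b) ≤ Y

instance (t s Y : ℕ) (G : ℕ → ℕ) (b : ℕ) : Decidable (IsShort t s Y G b) :=
  inferInstanceAs (Decidable (_ ≤ _))

/-- The position, relative to a short superblock, of the code of its block number `j`. -/
def codePos (t s β : ℕ) (G : ℕ → ℕ) (b j : ℕ) : ℕ :=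
  3 * s * β + ∑ i ∈ Finset.range j, codeLen t (blockSum t G (s * b + i))

/-- The number of bits for the superblock number `b`. -/
def supLen (t s β ω Y : ℕ) (G : ℕ → ℕ) (b : ℕ) : ℕ :=
  if IsShort t s Y G b then codePos t s β G b s else t * s * ω

/-- The number of bits for the first `b` superblocks. -/
def supPos (t s β ω Y : ℕ) (G : ℕ → ℕ) (b : ℕ) : ℕ :=
  ∑ i ∈ Finset.range b, supLen t s β ω Y G i

/-- Three numbers for each block of a short superblock: its sum, the sum of the previous ones and
the position of its code. -/
def blockRecord (t s β : ℕ) (G : ℕ → ℕ) (b k : ℕ) : ℕ :=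
  if k % 3 = 0 then G (t * (s * b + k / 3)) - G (t * s * b)
  else if k % 3 = 1 then codePos t s β G b (k / 3)
  else blockSum t G (s * b + k / 3)

/-- The representation of a superblock: block records and codes if it is short, and the
values themselves otherwise. -/
def supData (t s β ω Y : ℕ) (G code : ℕ → ℕ) (b : ℕ) : ℕ :=
  if IsShort t s Y G b then
    pack (fun _ => β) (blockRecord t s β G b) (3 * s) + 2 ^ (3 * s * β) *
      pack (fun i => codeLen t (blockSum t G (s * b + i))) (fun i => code (s * b + i)) s
  else pack (fun _ => ω) (fun j => G (t * s * b + j + 1)) (t * s)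

/-- Four numbers for each superblock: the sum of the previous ones, whether it is short, and the
position of its data, as a number of words and a number of bits. -/
def supRecord (t s β ω Y w : ℕ) (G : ℕ → ℕ) (k : ℕ) : ℕ :=
  if k % 4 = 0 then G (t * s * (k / 4))
  else if k % 4 = 1 then if IsShort t s Y G (k / 4) then 1 else 0
  else if k % 4 = 2 then supPos t s β ω Y G (k / 4) / w
  else supPos t s β ω Y G (k / 4) % w

theorem blockSum_le {t s Y : ℕ} {G : ℕ → ℕ} (hG : Monotone G) {b : ℕ} (hb : IsShort t s Y G b)
    {i : ℕ} (hi : i < s) : blockSum t G (s * b + i) ≤ Y := by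
  refine le_trans (tsub_le_tsub ?_ ?_) hb
  · refine hG ?_
    rw [mul_assoc]
    refine Nat.mul_le_mul_left _ ?_
    nlinarith
  · refine hG ?_
    rw [mul_assoc]
    exact Nat.mul_le_mul_left _ (by lia)

theorem add_two_pow_mul_lt {a b l k : ℕ} (ha : a < 2 ^ l) (hb : b < 2 ^ k) :
    a + 2 ^ l * b < 2 ^ (l + k) := by
  rw [pow_add]
  nlinarith

theorem codePos_le {t s β c Y : ℕ} {G : ℕ → ℕ} (hG : Monotone G)
    (hc : ∀ y ≤ Y, codeLen t y ≤ c) {b : ℕ} (hb : IsShort t s Y G b) {j : ℕ} (hj : j ≤ s) :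
    codePos t s β G b j ≤ 3 * s * β + s * c := by
  refine Nat.add_le_add_left ?_ _
  calc ∑ i ∈ Finset.range j, codeLen t (blockSum t G (s * b + i))
      ≤ ∑ i ∈ Finset.range j, c := Finset.sum_le_sum fun i hi => hc _ ?_
    _ = j * c := by simp
    _ ≤ s * c := Nat.mul_le_mul_right _ hj
  exact blockSum_le hG hb ((Finset.mem_range.1 hi).trans_le hj)

theorem supLen_le {t s β ω c Y : ℕ} {G : ℕ → ℕ} (hG : Monotone G)
    (hc : ∀ y ≤ Y, codeLen t y ≤ c) (b : ℕ) :
    supLen t s β ω Y G b ≤ 3 * s * β + s * c + t * s * ω := by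
  unfold supLen
  split_ifs with h
  · exact (codePos_le hG hc h le_rfl).trans (Nat.le_add_right _ _)
  · exact Nat.le_add_left _ _

/-- The bit string `X` consists of the low bits of all numbers, the superblock records, the decoding
table and the data of the superblocks, of at most `S` bits, in such a way that queries can be
answered. -/
def IsLayout (t s β ω c Y r w N l S : ℕ) (low G : ℕ → ℕ) (X : ℕ) : Prop :=
  (∀ k < N, X / 2 ^ (k * l) % 2 ^ l = low k) ∧
  ∀ b < r, ∃ F O, O ≤ S ∧
    X / 2 ^ (N * l + (4 * b) * ω) % 2 ^ ω = G (t * s * b) ∧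
    X / 2 ^ (N * l + (4 * b + 1) * ω) % 2 ^ ω = F ∧
    X / 2 ^ (N * l + (4 * b + 2) * ω) % 2 ^ ω = O / w ∧
    X / 2 ^ (N * l + (4 * b + 3) * ω) % 2 ^ ω = O % w ∧
    ((F = 0 ∧ ∀ j < t * s,
        X / 2 ^ (N * l + (4 * r * ω + ((Y + 1) * 2 ^ c * t * β + (O + j * ω)))) % 2 ^ ω =
          G (t * s * b + j + 1)) ∨
      (F = 1 ∧ ∀ i < s, ∃ A P y, y ≤ Y ∧ P ≤ 3 * s * β + s * c ∧
        X / 2 ^ (N * l + (4 * r * ω + ((Y + 1) * 2 ^ c * t * β + (O + (3 * i) * β)))) % 2 ^ β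
          = A ∧
        X / 2 ^ (N * l + (4 * r * ω + ((Y + 1) * 2 ^ c * t * β + (O + (3 * i + 1) * β))))
          % 2 ^ β = P ∧
        X / 2 ^ (N * l + (4 * r * ω + ((Y + 1) * 2 ^ c * t * β + (O + (3 * i + 2) * β))))
          % 2 ^ β = y ∧
        ∀ j < t, ∃ V, G (t * s * b) + A + V = G (t * s * b + t * i + j + 1) ∧
          X / 2 ^ (N * l + (4 * r * ω + ((y * 2 ^ c +
            X / 2 ^ (N * l + (4 * r * ω + ((Y + 1) * 2 ^ c * t * β + (O + P)))) % 2 ^ c)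
              * t + j) * β)) % 2 ^ β = V))

-- The string is the concatenation of low bits, superblock records, decoding table and superblock
-- data. The numeric hypotheses ensure that each number fits its field of `β` or `ω` bits.
set_option maxHeartbeats 1000000 in
theorem exists_layout {t s β ω c Y r w N l : ℕ} {low G : ℕ → ℕ} (ht : 0 < t) (hω : 0 < ω)
    (hlow : ∀ k < N, low k < 2 ^ l) (hG : Monotone G) (hGω : ∀ k, G k < 2 ^ ω) (hY : Y < 2 ^ β)
    (hβ : 3 * s * β + s * c < 2 ^ β) (hc : ∀ y ≤ Y, codeLen t y ≤ c)
    (hpos : r * (3 * s * β + s * c + t * s * ω) < 2 ^ ω) :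
    ∃ X, X < 2 ^ (N * l + (4 * r * ω + ((Y + 1) * 2 ^ c * t * β + supPos t s β ω Y G r))) ∧
      IsLayout t s β ω c Y r w N l (supPos t s β ω Y G r) low G X := by
  unfold IsLayout
  choose dec hdec_le hdec using exists_decoder t
  have hcode : ∀ k, ∃ z < 2 ^ codeLen t (blockSum t G k), ∀ j ≤ t,
      dec (blockSum t G k) z j = G (t * k + j) - G (t * k) := by
    intro k
    refine hdec _ (fun j => G (t * k + j) - G (t * k)) ?_ (by simp) ?_
    · intro a b h
      exact Nat.sub_le_sub_right (hG (by lia)) _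
    · rw [blockSum, Nat.mul_succ]
  choose code hcode_lt hcode_dec using hcode
  -- the four regions
  set T : ℕ → ℕ := fun k =>
    dec (k / t / 2 ^ c) (k / t % 2 ^ c % 2 ^ codeLen t (k / t / 2 ^ c)) (k % t + 1) with hT
  set NT := (Y + 1) * 2 ^ c * t with hNT
  set x₁ := pack (fun _ => l) low N with hx₁
  set x₂ := pack (fun _ => ω) (supRecord t s β ω Y w G) (4 * r) with hx₂
  set x₃ := pack (fun _ => β) T NT with hx₃
  set x₄ := pack (supLen t s β ω Y G) (supData t s β ω Y G code) r with hx₄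
  have hOle : ∀ b ≤ r, supPos t s β ω Y G b < 2 ^ ω := by
    intro b hb
    refine lt_of_le_of_lt ?_ hpos
    calc supPos t s β ω Y G b ≤ ∑ i ∈ Finset.range b, (3 * s * β + s * c + t * s * ω) :=
          Finset.sum_le_sum fun i _ => supLen_le hG hc i
      _ = b * (3 * s * β + s * c + t * s * ω) := by simp
      _ ≤ _ := Nat.mul_le_mul_right _ hb
  have h1ω : 1 < 2 ^ ω := Nat.one_lt_two_pow hω.ne'
  have hrec : ∀ k < 4 * r, supRecord t s β ω Y w G k < 2 ^ ω := by
    intro k hk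
    have hk4 := hOle (k / 4) (by lia)
    unfold supRecord
    split_ifs
    · exact hGω _
    · exact h1ω
    · exact h1ω.trans' one_pos
    · exact (Nat.div_le_self _ _).trans_lt hk4
    · exact (Nat.mod_le _ _).trans_lt hk4
  have hTlt : ∀ k < NT, T k < 2 ^ β := by
    intro k hk
    refine (hdec_le _ _ _).trans_lt (lt_of_le_of_lt ?_ hY)
    rw [Nat.div_div_eq_div_mul]
    refine Nat.le_of_lt_succ (Nat.div_lt_of_lt_mul ?_)
    rw [hNT] at hk
    calc k < _ := hk
      _ = _ := by rw [Nat.succ_eq_add_one]; ring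
  have hblk : ∀ b, IsShort t s Y G b → ∀ k < 3 * s, blockRecord t s β G b k < 2 ^ β := by
    intro b hb k hk
    unfold blockRecord
    split_ifs
    · refine lt_of_le_of_lt (le_trans (Nat.sub_le_sub_right (hG ?_) _) hb) hY
      rw [mul_assoc]
      refine Nat.mul_le_mul_left _ ?_
      have : k / 3 ≤ s := by lia
      nlinarith
    · exact (codePos_le hG hc hb (by lia)).trans_lt hβ
    · exact (blockSum_le hG hb (by lia)).trans_lt hY
  have hdata : ∀ b < r, supData t s β ω Y G code b < 2 ^ supLen t s β ω Y G b := by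
    intro b _
    unfold supData supLen
    split_ifs with h
    · have h1 := pack_const_lt (hblk b h)
      have h2 := pack_lt (len := fun i => codeLen t (blockSum t G (s * b + i)))
        (v := fun i => code (s * b + i)) (N := s) fun k _ => hcode_lt _
      exact add_two_pow_mul_lt h1 h2
    · exact pack_const_lt fun k _ => hGω _
  have l₁ : x₁ < 2 ^ (N * l) := pack_const_lt hlow
  have l₂ : x₂ < 2 ^ (4 * r * ω) := pack_const_lt hrec
  have l₃ : x₃ < 2 ^ (NT * β) := pack_const_lt hTlt
  have l₄ : x₄ < 2 ^ supPos t s β ω Y G r := pack_lt hdata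
  refine ⟨x₁ + 2 ^ (N * l) * (x₂ + 2 ^ (4 * r * ω) * (x₃ + 2 ^ (NT * β) * x₄)), ?_, ?_, ?_⟩
  · exact add_two_pow_mul_lt l₁ (add_two_pow_mul_lt l₂ (add_two_pow_mul_lt l₃ l₄))
  · intro k hk
    rw [add_two_pow_mul_field, pack_const_field hlow hk]
    rw [← Nat.succ_mul]
    exact Nat.mul_le_mul_right _ hk
  intro b hb
  have field₂ : ∀ q < 4, (x₁ + 2 ^ (N * l) * (x₂ + 2 ^ (4 * r * ω) * (x₃ + 2 ^ (NT * β) * x₄))) /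
      2 ^ (N * l + (4 * b + q) * ω) % 2 ^ ω = supRecord t s β ω Y w G (4 * b + q) := by
    intro q hq
    rw [add_two_pow_mul_div _ _ _ l₁, add_two_pow_mul_field, pack_const_field hrec (by lia)]
    rw [← Nat.succ_mul]
    exact Nat.mul_le_mul_right _ (by lia)
  have field₃ : ∀ k < NT, (x₁ + 2 ^ (N * l) * (x₂ + 2 ^ (4 * r * ω) * (x₃ + 2 ^ (NT * β) * x₄))) /
      2 ^ (N * l + (4 * r * ω + k * β)) % 2 ^ β = T k := by
    intro k hk
    rw [add_two_pow_mul_div _ _ _ l₁, add_two_pow_mul_div _ _ _ l₂, add_two_pow_mul_field,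
      pack_const_field hTlt hk]
    rw [← Nat.succ_mul]
    exact Nat.mul_le_mul_right _ hk
  have field₄ : ∀ p f, p + f ≤ supLen t s β ω Y G b →
      (x₁ + 2 ^ (N * l) * (x₂ + 2 ^ (4 * r * ω) * (x₃ + 2 ^ (NT * β) * x₄))) /
        2 ^ (N * l + (4 * r * ω + (NT * β + (supPos t s β ω Y G b + p)))) % 2 ^ f =
      supData t s β ω Y G code b / 2 ^ p % 2 ^ f := by
    intro p f h
    rw [add_two_pow_mul_div _ _ _ l₁, add_two_pow_mul_div _ _ _ l₂, add_two_pow_mul_div _ _ _ l₃,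
      supPos, pack_subfield hdata hb h]
  set X := x₁ + 2 ^ (N * l) * (x₂ + 2 ^ (4 * r * ω) * (x₃ + 2 ^ (NT * β) * x₄)) with hX
  clear_value X
  clear hX
  refine ⟨if IsShort t s Y G b then 1 else 0, supPos t s β ω Y G b,
    Finset.sum_le_sum_of_subset (Finset.range_mono hb.le), ?_, ?_, ?_, ?_, ?_⟩
  · have := field₂ 0 (by lia)
    rw [add_zero] at this
    rw [this, supRecord, if_pos (by lia), Nat.mul_div_cancel_left _ (by lia)]
  · rw [field₂ 1 (by lia), supRecord, if_neg (by lia), if_pos (by lia),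
      show (4 * b + 1) / 4 = b by lia]
  · rw [field₂ 2 (by lia), supRecord, if_neg (by lia), if_neg (by lia), if_pos (by lia),
      show (4 * b + 2) / 4 = b by lia]
  · rw [field₂ 3 (by lia), supRecord, if_neg (by lia), if_neg (by lia), if_neg (by lia),
      show (4 * b + 3) / 4 = b by lia]
  by_cases hS : IsShort t s Y G b
  swap
  · refine Or.inl ⟨if_neg hS, fun j hj => ?_⟩
    rw [field₄, supData, if_neg hS, pack_const_field (fun k _ => hGω _) hj]
    rw [supLen, if_neg hS, ← Nat.succ_mul]
    exact Nat.mul_le_mul_right _ hj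
  refine Or.inr ⟨if_pos hS, fun i hi => ?_⟩
  have field₅ : ∀ q < 3, X / 2 ^ (N * l + (4 * r * ω + (NT * β +
      (supPos t s β ω Y G b + (3 * i + q) * β)))) % 2 ^ β = blockRecord t s β G b (3 * i + q) := by
    intro q hq
    have hle : (3 * i + q) * β + β ≤ 3 * s * β := by
      rw [← Nat.succ_mul]
      exact Nat.mul_le_mul_right _ (by lia)
    rw [field₄, supData, if_pos hS, add_two_pow_mul_field _ _ hle,
      pack_const_field (hblk b hS) (by lia)]
    rw [supLen, if_pos hS, codePos]
    lia
  have field₆ : X / 2 ^ (N * l + (4 * r * ω + (NT * β +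
      (supPos t s β ω Y G b + codePos t s β G b i)))) % 2 ^ codeLen t (blockSum t G (s * b + i)) =
      code (s * b + i) := by
    rw [field₄, supData, if_pos hS, codePos, add_two_pow_mul_div _ _ _ (pack_const_lt (hblk b hS)),
      pack_field (len := fun i => codeLen t (blockSum t G (s * b + i)))
        (v := fun i => code (s * b + i)) (fun k _ => hcode_lt _) hi]
    rw [supLen, if_pos hS, codePos, codePos, add_assoc, ← Finset.sum_range_succ
      (fun i => codeLen t (blockSum t G (s * b + i)))]
    exact Nat.add_le_add_left (Finset.sum_le_sum_of_subset (Finset.range_mono hi)) _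
  have hy := blockSum_le hG hS hi
  refine ⟨G (t * (s * b + i)) - G (t * s * b), codePos t s β G b i, blockSum t G (s * b + i), hy,
    codePos_le hG hc hS hi.le, ?_, ?_, ?_,
    fun j hj => ⟨G (t * (s * b + i) + (j + 1)) - G (t * (s * b + i)), ?_, ?_⟩⟩
  · have := field₅ 0 (by lia)
    rw [add_zero] at this
    rw [this, blockRecord, if_pos (by lia), Nat.mul_div_cancel_left _ (by lia)]
  · rw [field₅ 1 (by lia), blockRecord, if_neg (by lia), if_pos (by lia),
      show (3 * i + 1) / 3 = i by lia]
  · rw [field₅ 2 (by lia), blockRecord, if_neg (by lia), if_neg (by lia),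
      show (3 * i + 2) / 3 = i by lia]
  · have h1 : G (t * s * b) ≤ G (t * (s * b + i)) := hG (by nlinarith)
    have h2 : G (t * (s * b + i)) ≤ G (t * (s * b + i) + (j + 1)) := hG (by lia)
    rw [show t * s * b + t * i + j + 1 = t * (s * b + i) + (j + 1) by ring]
    lia
  · set z := X / 2 ^ (N * l + (4 * r * ω + (NT * β +
      (supPos t s β ω Y G b + codePos t s β G b i)))) % 2 ^ c with hz
    set y := blockSum t G (s * b + i) with hydef
    have hzlt : z < 2 ^ c := Nat.mod_lt _ (by positivity)
    have hq : ((y * 2 ^ c + z) * t + j) / t = y * 2 ^ c + z := by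
      rw [mul_comm, Nat.mul_add_div ht, Nat.div_eq_of_lt hj, add_zero]
    have hm : ((y * 2 ^ c + z) * t + j) % t = j := by
      rw [Nat.mul_add_mod_self_right, Nat.mod_eq_of_lt hj]
    have hqd : (y * 2 ^ c + z) / 2 ^ c = y := by
      rw [mul_comm, Nat.mul_add_div (by positivity), Nat.div_eq_of_lt hzlt, add_zero]
    have hqm : (y * 2 ^ c + z) % 2 ^ c = z := by
      rw [Nat.mul_add_mod_self_right, Nat.mod_eq_of_lt hzlt]
    rw [field₃ _ ?_, hT]
    · simp only [hq, hm, hqd, hqm]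
      rw [hz, Nat.mod_mod_of_dvd _ (pow_dvd_pow 2 (hc _ hy)), field₆, hcode_dec _ _ (by lia)]
    · have h1 : y * 2 ^ c + z + 1 ≤ (Y + 1) * 2 ^ c := by
        have := Nat.mul_le_mul_right (2 ^ c) hy
        lia
      have h2 := Nat.mul_le_mul_right t h1
      rw [hNT]
      lia

/-! ### The query program -/

namespace Query

def one : Ex := .const 1
/-- The length of `n` in binary. -/
def lamE : Ex := (Ex.msb (.inp 0)).add one
/-- The length of the length of `n` in binary. -/
def muE : Ex := (Ex.msb lamE).add one
/-- The size of a block. -/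
def tE : Ex := muE.mul muE
/-- The number of blocks in a superblock. -/
def sE : Ex := one.shl muE
/-- The size of a superblock. -/
def supE : Ex := tE.mul sE
/-- The width of the fields of a block. -/
def betaE : Ex := (Ex.const 8).mul muE
/-- The width of the fields of a superblock. -/
def omegaE : Ex := (Ex.const 16).mul lamE
/-- The length of the longest code. -/
def codeE : Ex := tE.mul (((Ex.const 4).mul muE).add one)
/-- The largest sum of a short superblock. -/
def maxE : Ex := one.shl ((Ex.const 4).mul muE)
/-- The number of superblocks. -/
def countE : Ex := ((Ex.inp 0).div supE).add one
/-- The number of low bits that are stored separately. -/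
def lowLenE : Ex := (((Ex.inp 1).div (.inp 0)).div sE).msb
/-- The index, counted from zero. -/
def idxE : Ex := (Ex.inp 3).sub one
def supIdxE : Ex := idxE.div supE
def inSupE : Ex := idxE.rem supE
def blockIdxE : Ex := inSupE.div tE
def inBlockE : Ex := inSupE.rem tE
/-- The start of the superblock records. -/
def base₁ : Ex := (Ex.inp 0).mul lowLenE
/-- The start of the decoding table. -/
def base₂ : Ex := base₁.add (((Ex.const 4).mul countE).mul omegaE)
/-- The start of the data of the superblocks. -/
def base₃ : Ex :=
  base₂.add ((((maxE.add one).mul (one.shl codeE)).mul tE).mul betaE)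
/-- An entry of the superblock record. -/
def recE (q : ℕ) : Ex :=
  (Ex.const 0).field (base₁.add ((((Ex.const 4).mul supIdxE).add (.const q)).mul omegaE)) omegaE
/-- A field of the data of the superblock. -/
def dataE (p f : Ex) : Ex := (recE 2).field (((recE 3).add base₃).add p) f
/-- The result in a long superblock. -/
def longE : Ex := dataE (inSupE.mul omegaE) omegaE
/-- An entry of the block record. -/
def blockE (q : ℕ) : Ex :=
  dataE ((((Ex.const 3).mul blockIdxE).add (.const q)).mul betaE) betaE
/-- The code of the block, followed by other bits. -/
def windowE : Ex := dataE (blockE 1) codeE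
/-- The table entry for the block. -/
def tableE : Ex :=
  (Ex.const 0).field (base₂.add ((((((blockE 2).shl codeE).add windowE).mul tE).add
    inBlockE).mul betaE)) betaE
/-- The result in a short superblock. -/
def shortE : Ex := ((recE 0).add (blockE 0)).add tableE
-- The flag `recE 1` is 0 or 1 and selects between the two kinds of superblock by multiplication.
def highE : Ex := ((recE 1).mul shortE).add ((one.sub (recE 1)).mul longE)
def lowE : Ex := (Ex.const 0).field (idxE.mul lowLenE) lowLenE
def mainE : Ex := (highE.shl lowLenE).add lowE
/-- Whether the word size is greater than `K`. -/
def bigE (K : ℕ) : Ex := (Ex.const (2 ^ K)).div (.const (2 ^ K))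
/-- The query: for a word size up to `K`, the results are stored in words of their own. -/
def queryE (K : ℕ) : Ex :=
  ((bigE K).mul mainE).add ((one.sub (bigE K)).mul idxE.load)

end Query

open Query

theorem Ev.one {w : ℕ} {mem inp : ℕ → ℕ} (hw : 0 < w) : Ev w mem inp one 1 :=
  Ev.lit (Nat.one_lt_two_pow hw.ne')

/-- The constant `2 ^ K` is loaded modulo `2 ^ w`, hence as 0 when `w ≤ K`, and `0 / 0 = 0` on this
machine; this makes `bigE K` a test of the word size. -/
theorem eval_query_small {K w : ℕ} {mem inp : ℕ → ℕ} {i v : ℕ} (hw : 0 < w) (hK : w ≤ K)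
    (hi : inp 3 = i) (h1 : 1 ≤ i) (hiw : i < 2 ^ w) (hv : mem (i - 1) = v) (hvw : v < 2 ^ w) :
    Ev w mem inp (queryE K) v := by
  have hb : Ev w mem inp (bigE K) 0 := by
    have : Ev w mem inp (.const (2 ^ K)) 0 := by
      simp only [Ev, Ex.eval]
      exact Nat.mod_eq_zero_of_dvd (pow_dvd_pow 2 hK)
    have h := this.div this
    rwa [Nat.div_zero] at h
  have h1w : 1 < 2 ^ w := Nat.one_lt_two_pow hw.ne'
  have e1 : Ev w mem inp idxE (i - 1) := Ev.sub (show Ev w mem inp (.inp 3) i from hi) (.one hw) h1 hiw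
  have e2 := e1.load
  rw [hv] at e2
  have := (hb.zero_mul mainE).add (((Ev.one hw).sub hb (by lia) h1w).mul e2 (by simpa)) (by simpa)
  rwa [zero_add, Nat.sub_zero, one_mul] at this

theorem eval_query_big {K w : ℕ} {mem inp : ℕ → ℕ} {v : ℕ} (hK : K < w)
    (hv : Ev w mem inp mainE v) (hvw : v < 2 ^ w) : Ev w mem inp (queryE K) v := by
  have hb : Ev w mem inp (bigE K) 1 := by
    have : Ev w mem inp (.const (2 ^ K)) (2 ^ K) := .lit (Nat.pow_lt_pow_right one_lt_two hK)
    have h := this.div this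
    rwa [Nat.div_self (by positivity)] at h
  have hw : 0 < w := by lia
  have h1w : 1 < 2 ^ w := Nat.one_lt_two_pow hw.ne'
  have := (hb.mul hv (by simpa)).add
    (((Ev.one hw).sub hb le_rfl h1w).zero_mul (Ex.load idxE)) (by simpa)
  rwa [one_mul, add_zero] at this

-- The point is that no wanted value wraps around. A bit position may exceed `2 ^ w`, so the start
-- `O` of a superblock is used as a word number `O / w` and an offset. The offset sum stays below `2
-- ^ w`: half of that covers the low bits (`hnl`), a quarter the records, table and one superblock
-- (`hZ`), and a quarter `O % w`, because `4 * w ≤ 2 ^ w` for `w ≥ 8`.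
set_option maxHeartbeats 2000000 in
theorem eval_main {t s β ω c Y r w n l S X i : ℕ} {mem inp low G : ℕ → ℕ}
    (hX : IsLayout t s β ω c Y r w n l S low G X)
    (hmem : ∀ k, mem k = X / 2 ^ (k * w) % 2 ^ w)
    (hn : inp 0 = n) (hw : inp 2 = w) (hi : inp 3 = i) (h1 : 1 ≤ i) (hin : i ≤ n)
    (et : Ev w mem inp tE t) (es : Ev w mem inp sE s) (eβ : Ev w mem inp betaE β)
    (eω : Ev w mem inp omegaE ω) (ec : Ev w mem inp codeE c) (eY : Ev w mem inp maxE Y)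
    (er : Ev w mem inp countE r) (el : Ev w mem inp lowLenE l)
    (ht : 0 < t) (hs : 0 < s) (hβ : 0 < β) (hω : 0 < ω) (hir : (i - 1) / (t * s) < r)
    (hw8 : 8 ≤ w) (hnw : n < 2 ^ w) (hnl : 2 * (n * l) < 2 ^ w) (hS : S ≤ 2 ^ (w + 1))
    (hZ : 4 * (4 * r * ω + (Y + 1) * 2 ^ c * t * β + (3 * s * β + s * c + t * s * ω)) ≤ 2 ^ w)
    (hG : ∀ k, G k < 2 ^ w) (hlow : low (i - 1) < 2 ^ w)
    (hfin : G i * 2 ^ l + low (i - 1) < 2 ^ w) :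
    Ev w mem inp mainE (G i * 2 ^ l + low (i - 1)) := by
  have hw0 : 0 < w := by lia
  have h256 : 256 ≤ 2 ^ w := by
    calc 256 = 2 ^ 8 := by norm_num
      _ ≤ 2 ^ w := Nat.pow_le_pow_right two_pos hw8
  have hw4 : 4 * w ≤ 2 ^ w := by
    have : ∀ k, 8 ≤ k → 4 * k ≤ 2 ^ k := by
      intro k hk
      induction k, hk using Nat.le_induction with
      | base => norm_num
      | succ k hk ih => rw [pow_succ]; lia
    exact this w hw8
  set NT := (Y + 1) * 2 ^ c * t with hNT
  set Q := 2 ^ w with hQ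
  have eone : Ev w mem inp one 1 := .one hw0
  have ek : ∀ k < 256, Ev w mem inp (.const k) k := fun k hk => Ev.lit (hk.trans_le h256)
  have en : Ev w mem inp (.inp 0) n := hn
  -- bounds
  have b1 : ω ≤ t * s * ω := Nat.le_mul_of_pos_left _ (by positivity)
  have b2 : t * s ≤ t * s * ω := Nat.le_mul_of_pos_right _ hω
  have b3 : NT ≤ NT * β := Nat.le_mul_of_pos_right _ hβ
  have b4 : (Y + 1) * 2 ^ c ≤ NT := Nat.le_mul_of_pos_right _ ht
  have b5 : Y + 1 ≤ (Y + 1) * 2 ^ c := Nat.le_mul_of_pos_right _ (by positivity)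
  have b6 : 2 ^ c ≤ (Y + 1) * 2 ^ c := Nat.le_mul_of_pos_left _ (by lia)
  have b7 : 4 * r ≤ 4 * r * ω := Nat.le_mul_of_pos_right _ hω
  have hidx : i - 1 < n := by lia
  set b := (i - 1) / (t * s) with hb
  set k := (i - 1) % (t * s) with hk
  have hkts : k < t * s := Nat.mod_lt _ (by positivity)
  set j := k / t with hj
  set e := k % t with he
  have hjs : j < s := Nat.div_lt_of_lt_mul hkts
  have het : e < t := Nat.mod_lt _ ht
  have hkje : t * j + e = k := Nat.div_add_mod k t
  have hbk : t * s * b + k = i - 1 := Nat.div_add_mod _ _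
  -- expressions without memory access
  have esup : Ev w mem inp supE (t * s) := et.mul es (by lia)
  have eidx : Ev w mem inp idxE (i - 1) :=
    Ev.sub (show Ev w mem inp (.inp 3) i from hi) eone h1 (by lia)
  have eb : Ev w mem inp supIdxE b := eidx.div esup
  have eK : Ev w mem inp inSupE k := eidx.rem esup (by lia)
  have ej : Ev w mem inp blockIdxE j := eK.div et
  have ee : Ev w mem inp inBlockE e := eK.rem et (by lia)
  have ebase₁ : Ev w mem inp base₁ (n * l) := en.mul el (by lia)
  have ebase₂ : Ev w mem inp base₂ (n * l + 4 * r * ω) :=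
    ebase₁.add (((ek 4 (by lia)).mul er (by lia)).mul eω (by lia)) (by lia)
  have e2c : Ev w mem inp (one.shl codeE) (2 ^ c) := by
    simpa using eone.shl ec (by lia)
  have ebase₃ : Ev w mem inp base₃ (n * l + 4 * r * ω + NT * β) :=
    ebase₂.add ((((eY.add eone (by lia)).mul e2c (by lia)).mul et (by lia)).mul eβ (by lia))
      (by lia)
  obtain ⟨hlowX, hX⟩ := hX
  obtain ⟨F, O, hO, hr0, hr1, hr2, hr3, hcase⟩ := hX b hir
  -- reading at an absolute position
  have fld₀ : ∀ {p f : Ex} {R F v : ℕ}, Ev w mem inp p R → Ev w mem inp f F → R < Q →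
      X / 2 ^ R % 2 ^ F = v → v < Q → Ev w mem inp ((Ex.const 0).field p f) v := by
    intro p f R F v hp hf hR hv hvQ
    refine Ev.field hmem hw hw0 (ek 0 (by lia)) hp hf hR ?_ (by simp) hv hvQ
    have : R / w ≤ R / 8 := Nat.div_le_div_left hw8 (by lia)
    lia
  have hrec : ∀ q < 4, ∀ v, X / 2 ^ (n * l + (4 * b + q) * ω) % 2 ^ ω = v → v < Q →
      Ev w mem inp (recE q) v := by
    intro q hq v hv hvQ
    have hle : (4 * b + q) * ω ≤ 4 * r * ω := Nat.mul_le_mul_right _ (by lia)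
    exact fld₀ (ebase₁.add ((((ek 4 (by lia)).mul eb (by lia)).add (ek q (by lia))
      (by lia)).mul eω (by lia)) (by lia)) eω (by lia) hv hvQ
  have hOw : O / w ≤ O / 8 := Nat.div_le_div_left hw8 (by lia)
  have hS' : S ≤ 2 * Q := by rw [hQ, mul_comm, ← pow_succ]; exact hS
  have hOm : O % w < w := Nat.mod_lt _ hw0
  have er0 := hrec 0 (by lia) _ (by simpa using hr0) (hG _)
  have er2 := hrec 2 (by lia) _ hr2 (by lia)
  have er3 := hrec 3 (by lia) _ hr3 (by lia)
  -- reading at a position relative to the data of the superblock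
  have fld₁ : ∀ {p f : Ex} {R F v : ℕ}, Ev w mem inp p R → Ev w mem inp f F →
      R ≤ 3 * s * β + s * c + t * s * ω →
      X / 2 ^ (n * l + (4 * r * ω + (NT * β + (O + R)))) % 2 ^ F = v → v < Q →
      Ev w mem inp (dataE p f) v := by
    intro p f R F v hp hf hR hv hvQ
    refine Ev.field hmem hw hw0 er2 ((er3.add ebase₃ (by lia)).add hp (by lia)) hf (by lia) ?_ ?_
      hv hvQ
    · have : (O % w + (n * l + 4 * r * ω + NT * β) + R) / w ≤
          (O % w + (n * l + 4 * r * ω + NT * β) + R) / 8 := Nat.div_le_div_left hw8 (by lia)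
      lia
    · have := Nat.div_add_mod' O w
      lia
  have ehigh : Ev w mem inp highE (G i) := by
    have hik : t * s * b + k + 1 = i := by lia
    rcases hcase with ⟨rfl, hlong⟩ | ⟨rfl, hshort⟩
    · have er1 := hrec 1 (by lia) _ hr1 (by lia)
      have hv := hlong k hkts
      rw [hik] at hv
      have hle : k * ω ≤ t * s * ω := Nat.mul_le_mul_right _ hkts.le
      have elong : Ev w mem inp longE (G i) :=
        fld₁ (eK.mul eω (by lia)) eω (by lia) hv (hG i)
      have hGi := hG i
      have := (er1.zero_mul shortE).add ((eone.sub er1 (by lia) (by lia)).mul elong (by simpa))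
        (by simpa)
      rwa [zero_add, Nat.sub_zero, one_mul] at this
    · have er1 := hrec 1 (by lia) _ hr1 (by lia)
      obtain ⟨A, P, y, hy, hP, hA, hP', hy', htab⟩ := hshort j hjs
      obtain ⟨V, hV, hVX⟩ := htab e het
      rw [show t * s * b + t * j + e + 1 = i by lia] at hV
      have hGi := hG i
      have hblk : ∀ q < 3, ∀ v, X / 2 ^ (n * l + (4 * r * ω + (NT * β + (O + (3 * j + q) * β))))
          % 2 ^ β = v → v < Q → Ev w mem inp (blockE q) v := by
        intro q hq v hv hvQ
        have hle : (3 * j + q) * β ≤ 3 * s * β := Nat.mul_le_mul_right _ (by lia)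
        have hle' : 3 * j + q ≤ (3 * j + q) * β := Nat.le_mul_of_pos_right _ hβ
        exact fld₁ ((((ek 3 (by lia)).mul ej (by lia)).add (ek q (by lia)) (by lia)).mul eβ
          (by lia)) eβ (by lia) hv hvQ
      have eA := hblk 0 (by lia) A (by simpa using hA) (by lia)
      have eP := hblk 1 (by lia) P hP' (by lia)
      have ey := hblk 2 (by lia) y hy' (by lia)
      set z := X / 2 ^ (n * l + (4 * r * ω + (NT * β + (O + P)))) % 2 ^ c with hz
      have hzc : z < 2 ^ c := Nat.mod_lt _ (by positivity)
      have ez : Ev w mem inp windowE z := fld₁ eP ec (by lia) hz.symm (by lia)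
      have c1 : y * 2 ^ c + z + 1 ≤ (Y + 1) * 2 ^ c := by
        have := Nat.mul_le_mul_right (2 ^ c) hy
        lia
      have c2 : (y * 2 ^ c + z) * t + e + 1 ≤ NT := by
        have := Nat.mul_le_mul_right t c1
        rw [hNT]
        lia
      have c3 : ((y * 2 ^ c + z) * t + e) * β ≤ NT * β := Nat.mul_le_mul_right _ (by lia)
      have eV : Ev w mem inp tableE V :=
        fld₀ (ebase₂.add (((((ey.shl ec (by lia)).add ez (by lia)).mul et (by lia)).add ee
          (by lia)).mul eβ (by lia)) (by lia)) eβ (by lia) (by rw [add_assoc]; exact hVX) (by lia)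
      have eshort : Ev w mem inp shortE (G i) := by
        have := (er0.add eA (by lia)).add eV (by lia)
        rwa [hV] at this
      have := (er1.mul eshort (by simpa)).add ((eone.sub er1 le_rfl (by lia)).zero_mul longE)
        (by simpa)
      rwa [one_mul, add_zero] at this
  have hile : (i - 1) * l ≤ n * l := Nat.mul_le_mul_right _ hidx.le
  have elow : Ev w mem inp lowE (low (i - 1)) :=
    fld₀ (eidx.mul el (by lia)) el (by lia) (hlowX _ hidx) hlow
  exact (ehigh.shl el (by lia)).add elow hfin

/-! ### Space -/

theorem sum_range_blocks (f : ℕ → ℕ) (s r : ℕ) :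
    ∑ b ∈ Finset.range r, ∑ i ∈ Finset.range s, f (s * b + i) = ∑ k ∈ Finset.range (s * r), f k := by
  induction r with
  | zero => simp
  | succ r ih => rw [Finset.sum_range_succ, ih, Nat.mul_succ, Finset.sum_range_add]

theorem sum_blockSum {G : ℕ → ℕ} (hG : Monotone G) (t q : ℕ) :
    ∑ k ∈ Finset.range q, blockSum t G k = G (t * q) - G 0 := by
  have h : Monotone fun k => G (t * k) := fun a b hab => hG (Nat.mul_le_mul_left _ hab)
  simpa [blockSum] using Finset.sum_range_tsub h q

/-- Blocks entirely beyond `n` have sum 0 and empty codes. The possibly incomplete block `n / t` is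
charged `c` bits separately, so that the remaining ones contain at most `n` numbers, as the binomial
estimate needs. -/
theorem sum_short_codeLen_le {t s c Y n : ℕ} {G : ℕ → ℕ} (ht : 0 < t) (hs : 0 < s)
    (hG : Monotone G) (hGn : ∀ k ≥ n, G k = G n) (hc : ∀ y ≤ Y, codeLen t y ≤ c) (r : ℕ) :
    ∑ k ∈ Finset.range (s * r),
        (if IsShort t s Y G (k / s) then codeLen t (blockSum t G k) else 0) ≤
      ∑ k ∈ Finset.range (n / t), codeLen t (blockSum t G k) + c := by
  have hlast : (if IsShort t s Y G (n / t / s) then codeLen t (blockSum t G (n / t)) else 0) ≤ c := by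
    split_ifs with h
    · have := blockSum_le hG h (Nat.mod_lt (n / t) hs)
      rw [Nat.div_add_mod] at this
      exact hc _ this
    · exact Nat.zero_le _
  calc _ ≤ ∑ k ∈ Finset.range (n / t + 1),
        (if IsShort t s Y G (k / s) then codeLen t (blockSum t G k) else 0) := by
        refine Finset.sum_le_sum_of_ne_zero fun k _ hk => ?_
        by_contra hkn
        rw [Finset.mem_range, not_lt] at hkn
        have h1 : n ≤ t * k :=
          (Nat.lt_mul_div_succ n ht).le.trans (Nat.mul_le_mul_left _ hkn)
        have h2 : blockSum t G k = 0 := by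
          rw [blockSum, hGn _ h1, hGn _ (h1.trans (Nat.mul_le_mul_left _ k.le_succ)), Nat.sub_self]
        simp [h2, codeLen] at hk
    _ ≤ _ := by
        rw [Finset.sum_range_succ]
        refine Nat.add_le_add (Finset.sum_le_sum fun k _ => ?_) hlast
        split_ifs
        · exact le_rfl
        · exact Nat.zero_le _

/-- Each long superblock uses up more than `Y` of a total of at most `u`. -/
theorem card_long_le {t s Y u : ℕ} {G : ℕ → ℕ} (hG : Monotone G) (hu : ∀ k, G k ≤ u) (hY : 0 < Y)
    (r : ℕ) : ∑ b ∈ Finset.range r, (if IsShort t s Y G b then 0 else 1) ≤ u / Y := by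
  rw [Nat.le_div_iff_mul_le hY, Finset.sum_mul]
  calc _ ≤ ∑ b ∈ Finset.range r, blockSum (t * s) G b := by
        refine Finset.sum_le_sum fun b _ => ?_
        split_ifs with h
        · simp
        · rw [one_mul]
          exact (not_le.1 h).le
    _ ≤ u := by
        rw [sum_blockSum hG]
        exact (Nat.sub_le _ _).trans (hu _)

/-- The redundancy terms are, in order: splitting off low bits, rounding of code lengths, the
incomplete block, the block records, and the long superblocks. -/
theorem space_le {t s β ω c Y n m l K : ℕ} {G : ℕ → ℕ} (ht : 0 < t) (hs : 0 < s) (hY : 0 < Y)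
    (hK : 0 < K) (hG : Monotone G) (hGn : ∀ k ≥ n, G k = G n) (hu : ∀ k, G k ≤ m / 2 ^ l)
    (hc : ∀ y ≤ Y, codeLen t y ≤ c) (hl : l = 0 ∨ n * K ≤ m / 2 ^ l) (r : ℕ) :
    n * l + supPos t s β ω Y G r ≤ B n (m + n) +
      (2 * (n / K + 1) + n / t + c + r * (3 * s * β) + m / 2 ^ l / Y * (t * s * ω)) := by
  have h1 : supPos t s β ω Y G r ≤ r * (3 * s * β) +
      ∑ k ∈ Finset.range (s * r),
        (if IsShort t s Y G (k / s) then codeLen t (blockSum t G k) else 0) +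
      (∑ b ∈ Finset.range r, (if IsShort t s Y G b then 0 else 1)) * (t * s * ω) := by
    rw [← sum_range_blocks, Finset.sum_mul, show r * (3 * s * β) =
      ∑ b ∈ Finset.range r, 3 * s * β by simp, ← Finset.sum_add_distrib, ← Finset.sum_add_distrib]
    refine Finset.sum_le_sum fun b _ => ?_
    have : ∑ i ∈ Finset.range s, (if IsShort t s Y G ((s * b + i) / s)
          then codeLen t (blockSum t G (s * b + i)) else 0) =
        if IsShort t s Y G b then
          ∑ i ∈ Finset.range s, codeLen t (blockSum t G (s * b + i)) else 0 := by
      split_ifs with h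
      all_goals
        first
        | refine Finset.sum_congr rfl fun i hi => ?_
        | refine Finset.sum_eq_zero fun i hi => ?_
        rw [Nat.mul_add_div hs, Nat.div_eq_of_lt (Finset.mem_range.1 hi), add_zero]
        simp [h]
    rw [this, supLen]
    split_ifs
    · rw [codePos]; lia
    · lia
  have h2 := sum_short_codeLen_le ht hs hG hGn hc r
  have h3 := Nat.mul_le_mul_right (t * s * ω) (card_long_le (t := t) (s := s) hG hu hY r)
  have h4 : ∑ k ∈ Finset.range (n / t), codeLen t (blockSum t G k) + n * l ≤
      n / t + 2 * (n / K + 1) + B n (m + n) := by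
    rw [← Nat.pow_le_pow_iff_right (a := 2) one_lt_two, pow_add, pow_add, pow_add]
    calc 2 ^ (∑ k ∈ Finset.range (n / t), codeLen t (blockSum t G k)) * 2 ^ (n * l)
        ≤ 2 ^ (n / t) * (m / 2 ^ l + n).choose n * 2 ^ (n * l) := by
          refine Nat.mul_le_mul_right _ ((two_pow_sum_codeLen_le t _ _).trans
            (Nat.mul_le_mul_left _ (add_choose_mono ?_ (Nat.div_mul_le_self n t))))
          rw [sum_blockSum hG]
          exact (Nat.sub_le _ _).trans (hu _)
      _ = 2 ^ (n / t) * ((m / 2 ^ l + n).choose n * 2 ^ (n * l)) := mul_assoc _ _ _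
      _ ≤ 2 ^ (n / t) * (2 ^ (2 * (n / K + 1)) * (m + n).choose n) :=
          Nat.mul_le_mul_left _ (choose_mul_two_pow_le hK hl)
      _ ≤ 2 ^ (n / t) * (2 ^ (2 * (n / K + 1)) * 2 ^ B n (m + n)) := by
          gcongr
          exact choose_le_two_pow_B (by lia)
      _ = _ := (mul_assoc _ _ _).symm
  lia

/-! ### The parameters -/

/-- The length of `n` in binary. -/
def lam (n : ℕ) : ℕ := Nat.log 2 n + 1

/-- The length of the length of `n` in binary. -/
def mu (n : ℕ) : ℕ := Nat.log 2 (lam n) + 1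

/-- The length of the longest code of a block. -/
def maxCode (n : ℕ) : ℕ := mu n * mu n * (4 * mu n + 1)

/-- The number of superblocks. -/
def supCount (n : ℕ) : ℕ := n / (mu n * mu n * 2 ^ mu n) + 1

/-- The number of low bits that are stored separately. -/
def lowLen (n m : ℕ) : ℕ := Nat.log 2 (m / n / 2 ^ mu n)

/-- The size of the superblock records, the decoding table and one superblock. -/
def localSize (n : ℕ) : ℕ :=
  4 * supCount n * (16 * lam n) +
    (2 ^ (4 * mu n) + 1) * 2 ^ maxCode n * (mu n * mu n) * (8 * mu n) +
    (3 * 2 ^ mu n * (8 * mu n) + 2 ^ mu n * maxCode n + mu n * mu n * 2 ^ mu n * (16 * lam n))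

/-- A bound for the redundancy. -/
def overhead (n : ℕ) : ℕ :=
  2 * (n / 2 ^ mu n + 1) + n / (mu n * mu n) + maxCode n +
    supCount n * (3 * 2 ^ mu n * (8 * mu n)) +
    2 * n * 2 ^ mu n / 2 ^ (4 * mu n) * (mu n * mu n * 2 ^ mu n * (16 * lam n)) + localSize n

theorem lam_pos (n : ℕ) : 0 < lam n := Nat.succ_pos _

theorem mu_pos (n : ℕ) : 0 < mu n := Nat.succ_pos _

theorem lt_two_pow_lam (n : ℕ) : n < 2 ^ lam n := Nat.lt_pow_succ_log_self one_lt_two n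

theorem lam_lt_two_pow_mu (n : ℕ) : lam n < 2 ^ mu n := Nat.lt_pow_succ_log_self one_lt_two _

theorem two_pow_mu_le (n : ℕ) : 2 ^ mu n ≤ 2 * lam n := by
  have := Nat.pow_log_le_self 2 (lam_pos n).ne'
  rw [mu, pow_succ]
  lia

theorem mu_le_lam (n : ℕ) : mu n ≤ lam n := Nat.log_lt_self 2 (lam_pos n).ne'

/-- This upper bound on the universe of the high parts limits the number of long superblocks; the
companion lower bound `lowLen_eq_zero_or` makes the low bits cheap to separate. -/
theorem div_lowLen_lt {n m : ℕ} (hn : 0 < n) : m / 2 ^ lowLen n m < 2 * n * 2 ^ mu n := by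
  have h1 : m / (n * 2 ^ mu n) < 2 ^ (lowLen n m + 1) := by
    rw [← Nat.div_div_eq_div_mul]
    exact Nat.lt_pow_succ_log_self one_lt_two _
  rw [Nat.div_lt_iff_lt_mul (by positivity)] at h1 ⊢
  calc m < _ := h1
    _ = _ := by rw [pow_succ]; ring

theorem lowLen_eq_zero_or {n m : ℕ} :
    lowLen n m = 0 ∨ n * 2 ^ mu n * 2 ^ lowLen n m ≤ m := by
  rcases Nat.eq_zero_or_pos (m / n / 2 ^ mu n) with h | h
  · left
    rw [lowLen, h, Nat.log_zero_right]
  · right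
    have h1 : 2 ^ lowLen n m ≤ m / n / 2 ^ mu n := Nat.pow_log_le_self 2 h.ne'
    rw [Nat.div_div_eq_div_mul] at h1
    rw [mul_comm]
    exact (Nat.mul_le_mul_right _ h1).trans (Nat.div_mul_le_self _ _)

theorem two_mul_le_two_pow {l : ℕ} (hl : l ≠ 0) : 2 * l ≤ 2 ^ l := by
  obtain ⟨k, rfl⟩ := Nat.exists_eq_succ_of_ne_zero hl
  have : k < 2 ^ k := Nat.lt_two_pow_self
  rw [Nat.succ_eq_add_one, pow_succ]
  lia

/-- If `l ≠ 0`, then `n * 2 ^ l ≤ m` and `2 * l ≤ 2 ^ l`. Thus the low bits occupy less than half of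
the addressable range. -/
theorem two_mul_lowLen_le (n m : ℕ) : 2 * (n * lowLen n m) ≤ m := by
  rcases eq_or_ne (lowLen n m) 0 with h | h
  · simp [h]
  · have h1 := (lowLen_eq_zero_or (n := n) (m := m)).resolve_left h
    refine le_trans ?_ h1
    have h2 := two_mul_le_two_pow h
    have h3 : n * 2 ^ lowLen n m ≤ n * 2 ^ mu n * 2 ^ lowLen n m :=
      Nat.mul_le_mul_right _ (Nat.le_mul_of_pos_right _ (by positivity))
    nlinarith

/-- Justifies the width `8 * mu n`: positions inside a short superblock are polynomial in `p = 2 ^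
mu n`, of degree 4 after `mu n ≤ p`, against `p ^ 8`. -/
theorem blockField_bound (n : ℕ) :
    3 * 2 ^ mu n * (8 * mu n) + 2 ^ mu n * maxCode n < 2 ^ (8 * mu n) := by
  have h1 : mu n ≤ 2 ^ mu n := Nat.lt_two_pow_self.le
  have h2 : 2 ≤ 2 ^ mu n := by
    simpa using Nat.pow_le_pow_right two_pos (mu_pos n)
  rw [show 8 * mu n = mu n * 8 by ring, pow_mul, maxCode]
  generalize 2 ^ mu n = p at *
  generalize mu n = a at *
  have e1 : 3 * p * (a * 8) ≤ 3 * p * (p * 8) := by gcongr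
  have e2 : p * (a * a * (4 * a + 1)) ≤ p * (p * p * (4 * p + 1)) := by gcongr
  have e3 : 2 ^ 4 * p ^ 4 ≤ p ^ 8 := by
    rw [show p ^ 8 = p ^ 4 * p ^ 4 by ring]
    gcongr
  have e4 : 2 ^ 2 * p ^ 2 ≤ p ^ 4 := by
    rw [show p ^ 4 = p ^ 2 * p ^ 2 by ring]
    gcongr
  have e5 : 2 * p ^ 3 ≤ p ^ 4 := by
    rw [show p ^ 4 = p * p ^ 3 by ring]
    gcongr
  have e6 : 0 < p ^ 4 := by positivity
  nlinarith

/-- Justifies the width `16 * lam n` in the same way, with `p = 2 ^ lam n`. -/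
theorem supField_bound (n : ℕ) :
    supCount n * (3 * 2 ^ mu n * (8 * mu n) + 2 ^ mu n * maxCode n +
      mu n * mu n * 2 ^ mu n * (16 * lam n)) < 2 ^ (16 * lam n) := by
  have h1 : supCount n ≤ 2 ^ lam n :=
    (Nat.succ_le_succ (Nat.div_le_self _ _)).trans (lt_two_pow_lam n)
  have h2 : lam n ≤ 2 ^ lam n := Nat.lt_two_pow_self.le
  have h3 : 2 ^ mu n ≤ 2 * 2 ^ lam n := (two_pow_mu_le n).trans (by lia)
  have h4 : mu n ≤ 2 ^ lam n := (mu_le_lam n).trans h2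
  have h5 : 2 ≤ 2 ^ lam n := by
    simpa using Nat.pow_le_pow_right two_pos (lam_pos n)
  rw [show 2 ^ (16 * lam n) = (2 ^ lam n) ^ 16 by rw [mul_comm, pow_mul], maxCode]
  generalize 2 ^ lam n = p at *
  generalize 2 ^ mu n = q at *
  generalize mu n = a at *
  generalize lam n = b at *
  generalize supCount n = r at *
  calc r * (3 * q * (8 * a) + q * (a * a * (4 * a + 1)) + a * a * q * (16 * b))
      ≤ p * (3 * (2 * p) * (8 * p) + 2 * p * (p * p * (4 * p + 1)) + p * p * (2 * p) * (16 * p)) := by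
        gcongr
    _ = 48 * p ^ 3 + 2 * p ^ 4 + 40 * p ^ 5 := by ring
    _ ≤ 48 * p ^ 5 + 2 * p ^ 5 + 40 * p ^ 5 := by
        gcongr <;> lia
    _ < 2 ^ 11 * p ^ 5 := by
        have : 0 < p ^ 5 := by positivity
        lia
    _ ≤ p ^ 11 * p ^ 5 := by gcongr
    _ = p ^ 16 := by ring

theorem supField_value_bound {n : ℕ} : 2 * n * 2 ^ mu n ≤ 2 ^ (16 * lam n) := by
  have h1 := lt_two_pow_lam n
  have h2 : lam n ≤ 2 ^ lam n := Nat.lt_two_pow_self.le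
  have h3 : 2 ^ mu n ≤ 2 * 2 ^ lam n := (two_pow_mu_le n).trans (by lia)
  have h5 : 2 ≤ 2 ^ lam n := by
    simpa using Nat.pow_le_pow_right two_pos (lam_pos n)
  rw [show 2 ^ (16 * lam n) = (2 ^ lam n) ^ 16 by rw [mul_comm, pow_mul]]
  generalize 2 ^ lam n = p at *
  calc 2 * n * 2 ^ mu n ≤ 2 * p * (2 * p) := by gcongr
    _ = 2 ^ 2 * p ^ 2 := by ring
    _ ≤ p ^ 2 * p ^ 2 := by gcongr
    _ = p ^ 4 := by ring
    _ ≤ p ^ 16 := by gcongr <;> lia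

theorem codeLen_le_maxCode {n y : ℕ} (hy : y ≤ 2 ^ (4 * mu n)) :
    codeLen (mu n * mu n) y ≤ maxCode n := by
  refine codeLen_le ?_
  have : 0 < 2 ^ (4 * mu n) := by positivity
  rw [pow_succ]
  lia

open Query

/-- The parameter computations of the program. -/
theorem eval_params {n m w : ℕ} {mem inp : ℕ → ℕ} (hn : inp 0 = n) (hm : inp 1 = m)
    (hw : 8 ≤ w) (hZ : 4 * localSize n ≤ 2 ^ w) :
    Ev w mem inp tE (mu n * mu n) ∧ Ev w mem inp sE (2 ^ mu n) ∧
    Ev w mem inp betaE (8 * mu n) ∧ Ev w mem inp omegaE (16 * lam n) ∧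
    Ev w mem inp codeE (maxCode n) ∧ Ev w mem inp maxE (2 ^ (4 * mu n)) ∧
    Ev w mem inp countE (supCount n) ∧ Ev w mem inp lowLenE (lowLen n m) := by
  have h256 : 256 ≤ 2 ^ w := by
    calc 256 = 2 ^ 8 := by norm_num
      _ ≤ 2 ^ w := Nat.pow_le_pow_right two_pos hw
  have eone : Ev w mem inp one 1 := .one (by lia)
  have ek : ∀ k < 256, Ev w mem inp (.const k) k := fun k hk => Ev.lit (hk.trans_le h256)
  have en : Ev w mem inp (.inp 0) n := hn
  have em : Ev w mem inp (.inp 1) m := hm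
  have hμ := mu_pos n
  have hlam := lam_pos n
  rw [localSize] at hZ
  have b1 : 16 * lam n ≤ 4 * supCount n * (16 * lam n) :=
    Nat.le_mul_of_pos_left _ (by unfold supCount; lia)
  have b2 : 4 * supCount n ≤ 4 * supCount n * (16 * lam n) :=
    Nat.le_mul_of_pos_right _ (by lia)
  have hP : 0 < 2 ^ mu n := by positivity
  have b3 : 8 * mu n ≤ 3 * 2 ^ mu n * (8 * mu n) := Nat.le_mul_of_pos_left _ (by lia)
  have b4 : 3 * 2 ^ mu n ≤ 3 * 2 ^ mu n * (8 * mu n) := Nat.le_mul_of_pos_right _ (by lia)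
  have b5 : maxCode n ≤ 2 ^ mu n * maxCode n := Nat.le_mul_of_pos_left _ hP
  have b6 : mu n * mu n * 2 ^ mu n ≤ mu n * mu n * 2 ^ mu n * (16 * lam n) :=
    Nat.le_mul_of_pos_right _ (by lia)
  have b7 : mu n * mu n ≤ mu n * mu n * 2 ^ mu n := Nat.le_mul_of_pos_right _ hP
  have b8 : 2 ^ (4 * mu n) + 1 ≤
      (2 ^ (4 * mu n) + 1) * 2 ^ maxCode n * (mu n * mu n) * (8 * mu n) := by
    rw [mul_assoc, mul_assoc]
    exact Nat.le_mul_of_pos_right _ (by positivity)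
  have elam : Ev w mem inp lamE (lam n) := en.msb.add eone (by rw [← lam]; lia)
  have eμ : Ev w mem inp muE (mu n) := elam.msb.add eone (by rw [← mu]; lia)
  have et : Ev w mem inp tE (mu n * mu n) := eμ.mul eμ (by lia)
  have es : Ev w mem inp sE (2 ^ mu n) := by
    have := eone.shl eμ (by lia)
    rwa [one_mul] at this
  have e4 := (ek 4 (by lia)).mul eμ (by lia)
  refine ⟨et, es, (ek 8 (by lia)).mul eμ (by lia), (ek 16 (by lia)).mul elam (by lia),
    et.mul (e4.add eone (by lia)) (by rw [← maxCode]; lia), ?_,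
    (en.div (et.mul es (by lia))).add eone (by rw [← supCount]; lia), ((em.div en).div es).msb⟩
  have := eone.shl e4 (by lia)
  rwa [one_mul] at this

/-- The representation for word sizes that are not bounded. -/
theorem exists_representation {n m w : ℕ} (hn : 0 < n) (hmn : m + n < 2 ^ w) (hw : 8 ≤ w)
    (hD : 4 * overhead n ≤ 2 ^ w) (x : Fin n → ℕ) (hx : ∑ j, x j ≤ m) :
    ∃ X < 2 ^ (B n (m + n) + overhead n), ∀ mem inp : ℕ → ℕ, ∀ i,
      (∀ k, mem k = X / 2 ^ (k * w) % 2 ^ w) → inp 0 = n → inp 1 = m → inp 2 = w → inp 3 = i →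
      1 ≤ i → i ≤ n → Ev w mem inp mainE (prefixSum x i) := by
  set l := lowLen n m with hl
  have hHm : ∀ k, prefixSum x k ≤ m := fun k => (prefixSum_le_sum x k).trans hx
  set G : ℕ → ℕ := fun k => prefixSum x k / 2 ^ l with hG
  have hGmono : Monotone G := fun a b h => Nat.div_le_div_right (prefixSum_mono x h)
  have hGu : ∀ k, G k ≤ m / 2 ^ l := fun k => Nat.div_le_div_right (hHm k)
  -- Prefix sums are constant beyond `n`, which pads the last superblock with zeros.
  have hGn : ∀ k ≥ n, G k = G n := fun k hk => by
    simp only [hG, prefixSum_of_le x hk, prefixSum_of_le x le_rfl]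
  have hμ := mu_pos n
  have hu := div_lowLen_lt (m := m) hn
  have hl' : l = 0 ∨ n * 2 ^ mu n ≤ m / 2 ^ l := by
    refine lowLen_eq_zero_or.imp_right fun h => ?_
    rwa [Nat.le_div_iff_mul_le (by positivity)]
  have hspace := space_le (t := mu n * mu n) (s := 2 ^ mu n) (β := 8 * mu n) (ω := 16 * lam n)
    (c := maxCode n) (Y := 2 ^ (4 * mu n)) (by positivity) (by positivity) (by positivity)
    (K := 2 ^ mu n) (by positivity) hGmono hGn hGu (fun y hy => codeLen_le_maxCode hy) hl'
    (supCount n)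
  have hlong : m / 2 ^ l / 2 ^ (4 * mu n) * (mu n * mu n * 2 ^ mu n * (16 * lam n)) ≤
      2 * n * 2 ^ mu n / 2 ^ (4 * mu n) * (mu n * mu n * 2 ^ mu n * (16 * lam n)) :=
    Nat.mul_le_mul_right _ (Nat.div_le_div_right hu.le)
  -- From `choose ≤ 2 ^ (m + n)`; this bounds the superblock data by `2 ^ (w + 1)` bits.
  have hB : B n (m + n) ≤ m + n := (B_le_iff (by lia)).2 (Nat.choose_le_two_pow _ _)
  obtain ⟨X, hXlt, hX⟩ := exists_layout (t := mu n * mu n) (s := 2 ^ mu n) (β := 8 * mu n)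
    (ω := 16 * lam n) (c := maxCode n) (Y := 2 ^ (4 * mu n)) (r := supCount n) (w := w) (N := n)
    (l := l) (low := fun k => prefixSum x (k + 1) % 2 ^ l) (G := G) (by positivity)
    (by have := lam_pos n; lia) (fun k _ => Nat.mod_lt _ (by positivity)) hGmono
    (fun k => (hGu k).trans_lt (hu.trans_le supField_value_bound))
    (Nat.pow_lt_pow_right one_lt_two (by lia)) (blockField_bound n)
    (fun y hy => codeLen_le_maxCode hy) (supField_bound n)
  have hnl := two_mul_lowLen_le n m
  have hover := overhead.eq_1 n
  have hloc := localSize.eq_1 n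
  refine ⟨X, hXlt.trans_le (Nat.pow_le_pow_right two_pos (by lia)), ?_⟩
  intro mem inp i hmem h0 h1 h2 h3 hi1 hin
  obtain ⟨et, es, eβ, eω, ec, eY, er, el⟩ := eval_params (mem := mem) h0 h1 hw (by lia)
  have hdecomp : G i * 2 ^ l + prefixSum x (i - 1 + 1) % 2 ^ l = prefixSum x i := by
    rw [Nat.sub_add_cancel hi1]
    exact Nat.div_add_mod' _ _
  have hHi := hHm i
  have key := eval_main hX hmem h0 h2 h3 hi1 hin et es eβ eω ec eY er el (by positivity)
    (by positivity) (by lia) (by have := lam_pos n; lia)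
    (Nat.lt_succ_of_le (Nat.div_le_div_right (by lia))) hw (by lia) (by lia)
    (by rw [pow_succ]; lia) (by lia)
    (fun k => (Nat.div_le_self _ _).trans_lt ((hHm k).trans_lt (by lia)))
    ((Nat.mod_le _ _).trans_lt ((hHm _).trans_lt (by lia))) (by rw [hdecomp]; lia)
  rwa [hdecomp] at key

/-! ### The redundancy is of lower order -/

theorem cube_le_two_pow {a : ℕ} (ha : 20 ≤ a) : 17 * a ^ 3 + 1 ≤ 2 ^ (a - 1) := by
  induction a, ha using Nat.le_induction with
  | base => norm_num
  | succ a ha ih =>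
    rw [show a + 1 - 1 = a - 1 + 1 by lia, pow_succ]
    have h : 17 * (a + 1) ^ 3 + 1 ≤ (17 * a ^ 3 + 1) * 2 := by
      have e1 : 20 * a ^ 2 ≤ a ^ 3 := by
        rw [pow_succ a 2, mul_comm]
        gcongr
      have e2 : 20 * a ≤ a ^ 2 := by
        rw [sq]
        gcongr
      have e3 : (a + 1) ^ 3 = a ^ 3 + 3 * a ^ 2 + 3 * a + 1 := by ring
      rw [e3]
      lia
    exact h.trans (Nat.mul_le_mul_right _ ih)

/-- The exponent is at most `17 * mu n ^ 3`, a power of `lg lg n`, hence below `lg n`. The threshold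
20 serves the induction in `cube_le_two_pow`. This makes the decoding table negligible. -/
theorem two_pow_le_of_mu {n : ℕ} (hn : n ≠ 0) (h : 20 ≤ mu n) :
    2 ^ (12 * mu n + maxCode n) ≤ n := by
  have h1 : 2 ^ (mu n - 1) ≤ lam n := Nat.pow_log_le_self 2 (lam_pos n).ne'
  have h2 : 2 ^ (lam n - 1) ≤ n := Nat.pow_log_le_self 2 hn
  refine le_trans (Nat.pow_le_pow_right two_pos ?_) h2
  have h3 := cube_le_two_pow h
  have h4 : 12 * mu n + maxCode n ≤ 17 * mu n ^ 3 := by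
    rw [maxCode]
    have e1 : 1 ≤ mu n := mu_pos n
    have e2 : mu n ≤ mu n ^ 3 := Nat.le_self_pow (by lia) _
    have e3 : mu n ^ 2 ≤ mu n ^ 3 := Nat.pow_le_pow_right e1 (by lia)
    have e4 : mu n * mu n * (4 * mu n + 1) = 4 * mu n ^ 3 + mu n ^ 2 := by ring
    lia
  lia

/-- With `p = 2 ^ mu n` one has `lam n ≤ p`, `mu n ^ 3 ≤ p` and `p ^ 12 * 2 ^ maxCode n ≤ n`. Each
term of `overhead n`, multiplied by `mu n`, is then a constant times `n`; 220 bounds the total of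
these constants. -/
theorem mu_mul_overhead_le {n : ℕ} (hn : n ≠ 0) (h : 20 ≤ mu n) :
    mu n * overhead n ≤ 220 * n := by
  have hbig := two_pow_le_of_mu hn h
  have hc : 0 < 2 ^ maxCode n := by positivity
  have hcube : mu n ^ 3 ≤ 2 ^ mu n := by
    have := cube_le_two_pow h
    have h2 : 2 ^ (mu n - 1) ≤ 2 ^ mu n := Nat.pow_le_pow_right two_pos (by lia)
    lia
  have hap : mu n ≤ 2 ^ mu n := Nat.lt_two_pow_self.le
  have hbp := (lam_lt_two_pow_mu n).le
  have hp2 : 2 ≤ 2 ^ mu n := by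
    simpa using Nat.pow_le_pow_right two_pos (mu_pos n)
  have hmc := maxCode.eq_1 n
  have ha := mu_pos n
  rw [overhead, localSize, supCount]
  rw [pow_add, show 12 * mu n = mu n * 12 by ring, pow_mul] at hbig
  rw [show 4 * mu n = mu n * 4 by ring, pow_mul]
  generalize 2 ^ maxCode n = C at *
  generalize maxCode n = c at *
  generalize 2 ^ mu n = p at *
  generalize mu n = a at *
  generalize lam n = b at *
  have hp12 : p ^ 12 ≤ n := (Nat.le_mul_of_pos_right _ hc).trans hbig
  have hc5 : c ≤ 5 * p ^ 3 := by
    calc c = a * a * (4 * a + 1) := hmc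
      _ ≤ p * p * (4 * p + p) := by gcongr; lia
      _ = 5 * p ^ 3 := by ring
  have hpk : ∀ k ≤ 11, p ^ k * 2 ≤ p ^ 12 := fun k hk => by
    calc p ^ k * 2 ≤ p ^ 11 * p := Nat.mul_le_mul (Nat.pow_le_pow_right (by lia) hk) hp2
      _ = p ^ 12 := by ring
  have hp7 : 2 ^ 7 * p ^ 5 ≤ p ^ 12 := by
    rw [show p ^ 12 = p ^ 7 * p ^ 5 by ring]
    gcongr
  have q1 : a * (n / p) ≤ n :=
    (Nat.mul_le_mul_right _ hap).trans (Nat.mul_div_le n p)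
  have q2 : a * (n / (a * a)) ≤ n :=
    (Nat.mul_le_mul_right _ (Nat.le_mul_of_pos_left a ha)).trans (Nat.mul_div_le n (a * a))
  have q3 : a * c ≤ 5 * p ^ 4 := by
    calc a * c ≤ p * (5 * p ^ 3) := by gcongr
      _ = _ := by ring
  have q4 : a * a * p * (n / (a * a * p)) ≤ n := Nat.mul_div_le _ _
  have q4' : a * a * p ≤ p ^ 3 := by
    calc a * a * p ≤ p * p * p := by gcongr
      _ = _ := by ring
  have q5 : a * ((n / (a * a * p) + 1) * (3 * p * (8 * a))) ≤ 48 * n := by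
    calc a * ((n / (a * a * p) + 1) * (3 * p * (8 * a)))
        = 24 * (a * a * p * (n / (a * a * p)) + a * a * p) := by ring
      _ ≤ 24 * (n + n) := by
          have := hpk 3 (by lia)
          gcongr
          lia
      _ = _ := by ring
  have q6 : a * (2 * n * p / p ^ 4 * (a * a * p * (16 * b))) ≤ 32 * n := by
    have h1 : 2 * n * p / p ^ 4 = 2 * n / p ^ 3 := by
      rw [pow_succ, Nat.mul_div_mul_right _ _ (by lia)]
    rw [h1]
    calc a * (2 * n / p ^ 3 * (a * a * p * (16 * b)))
        = 16 * (2 * n / p ^ 3) * (a ^ 3 * p * b) := by ring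
      _ ≤ 16 * (2 * n / p ^ 3) * (p * p * p) := by gcongr
      _ = 16 * (p ^ 3 * (2 * n / p ^ 3)) := by ring
      _ ≤ 16 * (2 * n) := Nat.mul_le_mul_left _ (Nat.mul_div_le _ _)
      _ = _ := by ring
  have q7 : a * (4 * (n / (a * a * p) + 1) * (16 * b)) ≤ 128 * n := by
    calc a * (4 * (n / (a * a * p) + 1) * (16 * b))
        ≤ a * (4 * (n / (a * a * p) + 1) * (16 * (a * p))) := by
          gcongr
          exact hbp.trans (Nat.le_mul_of_pos_left _ ha)
      _ = 64 * (a * a * p * (n / (a * a * p)) + a * a * p) := by ring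
      _ ≤ 64 * (n + n) := by
          have := hpk 3 (by lia)
          gcongr
          lia
      _ = _ := by ring
  have q8 : a * ((p ^ 4 + 1) * C * (a * a) * (8 * a)) ≤ n := by
    calc a * ((p ^ 4 + 1) * C * (a * a) * (8 * a))
        ≤ p * ((p ^ 4 + p ^ 4) * C * (p * p) * (8 * p)) := by
          gcongr
          exact Nat.one_le_pow _ _ (by lia)
      _ = 2 ^ 4 * p ^ 8 * C := by ring
      _ ≤ p ^ 4 * p ^ 8 * C := by gcongr
      _ = p ^ 12 * C := by ring
      _ ≤ n := hbig
  have q9 : a * (3 * p * (8 * a) + p * c + a * a * p * (16 * b)) ≤ n := by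
    calc a * (3 * p * (8 * a) + p * c + a * a * p * (16 * b))
        ≤ p * (3 * p * (8 * p) + p * (5 * p ^ 3) + p * p * p * (16 * p)) := by gcongr
      _ = 24 * p ^ 3 + 21 * p ^ 5 := by ring
      _ ≤ 24 * p ^ 5 + 21 * p ^ 5 := by gcongr <;> lia
      _ ≤ 2 ^ 7 * p ^ 5 := by lia
      _ ≤ n := hp7.trans hp12
  have q10 : 2 * a ≤ n := by
    have := hpk 1 (by lia)
    lia
  have q11 : 5 * p ^ 4 ≤ n := by
    calc 5 * p ^ 4 ≤ 2 ^ 7 * p ^ 5 := by gcongr <;> lia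
      _ ≤ n := hp7.trans hp12
  simp only [mul_add] at q5 q6 q7 q8 q9 ⊢
  lia

theorem le_mu {A n : ℕ} (h : 2 ^ 2 ^ A ≤ n) : A ≤ mu n := by
  have h1 : 2 ^ A ≤ Nat.log 2 n := Nat.le_log_of_pow_le one_lt_two h
  have h2 : A ≤ Nat.log 2 (lam n) := Nat.le_log_of_pow_le one_lt_two (h1.trans (Nat.le_succ _))
  exact h2.trans (Nat.le_succ _)

theorem mul_overhead_le {k n : ℕ} (h : 2 ^ 2 ^ (220 * k + 20) ≤ n) : k * overhead n ≤ n := by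
  have hn : n ≠ 0 := by
    have : 0 < 2 ^ 2 ^ (220 * k + 20) := by positivity
    lia
  have h1 := le_mu h
  have h2 := mu_mul_overhead_le hn (by lia)
  have h3 : 220 * k * overhead n ≤ mu n * overhead n := Nat.mul_le_mul_right _ (by lia)
  lia

theorem overhead_isLittleO (C : ℕ) :
    (fun n : ℕ => ((overhead n + C : ℕ) : ℝ)) =o[Filter.atTop] (fun n : ℕ => (n : ℝ)) := by
  rw [Asymptotics.isLittleO_iff]
  intro ε hε
  obtain ⟨k, hk⟩ := exists_nat_gt (2 / ε)
  filter_upwards [Filter.eventually_ge_atTop (2 ^ 2 ^ (220 * k + 20)),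
    Filter.eventually_ge_atTop (k * C)] with n h1 h2
  have h3 : k * (overhead n + C) ≤ 2 * n := by
    have := mul_overhead_le h1
    lia
  have h4 : (k : ℝ) * (overhead n + C : ℕ) ≤ 2 * n := by exact_mod_cast h3
  rw [Real.norm_natCast, Real.norm_natCast]
  have hk0 : 0 < (k : ℝ) := (by positivity : (0 : ℝ) < 2 / ε).trans hk
  have h5 : 2 < k * ε := by rwa [div_lt_iff₀ hε] at hk
  refine le_of_mul_le_mul_left (h4.trans ?_) hk0
  rw [← mul_assoc]
  gcongr

/-- A bound for the word size above which the compressed representation can be addressed. -/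
theorem exists_wordSize_bound : ∃ K, 8 ≤ K ∧ ∀ w > K, ∀ n < 2 ^ w, 4 * overhead n ≤ 2 ^ w := by
  set N := 2 ^ 2 ^ (220 * 4 + 20) with hN
  clear_value N
  -- For `n ≥ N`, `4 * overhead n ≤ n`. The finitely many smaller `n` are covered because `K`, and
  -- so `2 ^ w`, exceeds their overheads.
  refine ⟨8 + ∑ n ∈ Finset.range N, 4 * overhead n, by lia, fun w hw n hn => ?_⟩
  rcases lt_or_ge n N with h | h
  · have h1 : 4 * overhead n ≤ ∑ n ∈ Finset.range N, 4 * overhead n :=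
      Finset.single_le_sum (f := fun n => 4 * overhead n) (fun _ _ => Nat.zero_le _)
        (Finset.mem_range.2 h)
    have h2 : w < 2 ^ w := Nat.lt_two_pow_self
    lia
  · rw [hN] at h
    exact (mul_overhead_le h).trans hn.le

open Query

/-- `K * 2 ^ K` pays for the verbatim table used when `w ≤ K`: it has `n ≤ 2 ^ K` words of at most
`K` bits. The length is the same in both regimes. -/
theorem exists_bits {K : ℕ} (h8 : 8 ≤ K) (hK : ∀ w > K, ∀ n < 2 ^ w, 4 * overhead n ≤ 2 ^ w)
    {n m w : ℕ} (hmn : m + n < 2 ^ w) (x : Fin n → ℕ) (hx : ∑ j, x j ≤ m) :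
    ∃ bits : BitVec (B n (m + n) + (overhead n + K * 2 ^ K)), ∀ i, 1 ≤ i → i ≤ n →
      Answers (queryE K).program (queryE K).program.length n m w bits i (prefixSum x i) := by
  rcases Nat.eq_zero_or_pos n with rfl | hn
  · exact ⟨0, fun i h1 h2 => by lia⟩
  have hHw : ∀ k, prefixSum x k < 2 ^ w := fun k =>
    ((prefixSum_le_sum x k).trans hx).trans_lt (by lia)
  suffices h : ∃ X < 2 ^ (B n (m + n) + (overhead n + K * 2 ^ K)), ∀ mem inp : ℕ → ℕ, ∀ i,
      (∀ k, mem k = X / 2 ^ (k * w) % 2 ^ w) → inp 0 = n → inp 1 = m → inp 2 = w → inp 3 = i →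
      1 ≤ i → i ≤ n → Ev w mem inp (queryE K) (prefixSum x i) by
    obtain ⟨X, hX, h⟩ := h
    refine ⟨BitVec.ofNat _ X, fun i h1 h2 => ?_⟩
    have key := Ex.program_answers (queryE K) n m w i
      (BitVec.ofNat (B n (m + n) + (overhead n + K * 2 ^ K)) X)
    have hev := h (memory w (BitVec.ofNat (B n (m + n) + (overhead n + K * 2 ^ K)) X))
      (inputs n m w i) i (fun k => by rw [memory, BitVec.toNat_ofNat, Nat.mod_eq_of_lt hX])
      rfl rfl rfl rfl h1 h2
    rw [Ev] at hev
    rwa [hev] at key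
  rcases Nat.lt_or_ge K w with hw | hw
  · obtain ⟨X, hX, h⟩ := exists_representation hn hmn (by lia) (hK w hw n (by lia)) x hx
    refine ⟨X, hX.trans_le (Nat.pow_le_pow_right two_pos (by lia)), ?_⟩
    intro mem inp i hmem h0 h1 h2 h3 hi1 hin
    exact eval_query_big hw (h mem inp i hmem h0 h1 h2 h3 hi1 hin) (hHw i)
  · have hw0 : 0 < w := by
      by_contra h
      rw [Nat.eq_zero_of_not_pos h, pow_zero] at hmn
      lia
    have hfit : ∀ k < n, prefixSum x (k + 1) < 2 ^ w := fun k _ => hHw _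
    refine ⟨pack (fun _ => w) (fun k => prefixSum x (k + 1)) n, (pack_const_lt hfit).trans_le
      (Nat.pow_le_pow_right two_pos ?_), ?_⟩
    · have h1 : n ≤ 2 ^ K :=
        (show n ≤ 2 ^ w by lia).trans (Nat.pow_le_pow_right two_pos hw)
      have h2 := Nat.mul_le_mul h1 hw
      lia
    intro mem inp i hmem h0 h1 h2 h3 hi1 hin
    refine eval_query_small hw0 hw h3 hi1 (by lia) ?_ (hHw i)
    rw [hmem, pack_const_field hfit (by lia), Nat.sub_add_cancel hi1]

/-! ### Multisets -/

theorem exists_monotone_enumeration {m n : ℕ} (M : Multiset (Fin m)) (hM : M.card = n) :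
    ∃ h : Fin n → Fin m, Monotone h ∧ M = Finset.univ.val.map h := by
  subst hM
  have hlen : (M.sort (· ≤ ·)).length = M.card := Multiset.length_sort _
  refine ⟨fun j => (M.sort (· ≤ ·)).get (j.cast hlen.symm), ?_, ?_⟩
  · intro a b hab
    exact (Multiset.pairwise_sort M (· ≤ ·)).sortedLE.monotone_get hab
  · rw [Fin.univ_val_map]
    conv_lhs => rw [← Multiset.sort_eq M (· ≤ ·)]
    congr 1
    refine List.ext_get (by simp) fun k h1 h2 => by simp

/-- Elements below `h j` sit at indices before `j`, so `h j` has rank at most `j`. A larger element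
has all of the indices `0, …, j` below it, hence rank at least `j + 1`. -/
theorem isSelectm_enumeration {m n : ℕ} {h : Fin n → Fin m} (hh : Monotone h) (j : Fin n) :
    IsSelectm (j + 1) (Finset.univ.val.map h) (h j) := by
  have hcount : ∀ x, (Finset.univ.val.map h).countP (· < x) =
      (Finset.univ.filter fun k => h k < x).card := fun x => by
    rw [Multiset.countP_map]
    rfl
  constructor
  · refine ⟨Multiset.mem_map_of_mem _ (Finset.mem_univ_val j), ?_⟩
    rw [rankm, if_pos (Multiset.mem_map_of_mem _ (Finset.mem_univ_val j)), hcount]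
    have : (Finset.univ.filter fun k => h k < h j).card ≤ (Finset.Iio j).card := by
      refine Finset.card_le_card fun k hk => ?_
      rw [Finset.mem_filter] at hk
      rw [Finset.mem_Iio]
      by_contra hkj
      exact absurd (hh (not_lt.1 hkj)) (not_le.2 hk.2)
    rw [Fin.card_Iio] at this
    push_cast
    lia
  · rintro x ⟨hx, hr⟩
    by_contra hlt
    rw [not_le] at hlt
    rw [rankm, if_pos hx, hcount] at hr
    have : (Finset.Iic j).card ≤ (Finset.univ.filter fun k => h k < x).card := by
      refine Finset.card_le_card fun k hk => ?_
      rw [Finset.mem_Iic] at hk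
      simp only [Finset.mem_filter, Finset.mem_univ, true_and]
      exact (hh hk).trans_lt hlt
    rw [Fin.card_Iic] at this
    push_cast at hr
    lia

/-- The elements of a multiset in ascending order are the prefix sums of a sequence. -/
theorem exists_sequence {m n : ℕ} (M : Multiset (Fin m)) (hM : M.card = n) :
    ∃ x : Fin n → ℕ, ∑ j, x j ≤ m ∧ ∀ i, 1 ≤ i → i ≤ n →
      ∃ v : Fin m, IsSelectm i M v ∧ prefixSum x i = v := by
  obtain ⟨h, hh, rfl⟩ := exists_monotone_enumeration M hM
  rcases Nat.eq_zero_or_pos n with rfl | hn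
  · exact ⟨0, by simp, fun i h1 h2 => by lia⟩
  -- Shifting the sorted list by one makes room for `f 0 = 0`; `min` keeps the index valid and `f`
  -- constant from `n` on.
  set f : ℕ → ℕ := fun k => if k = 0 then 0 else h ⟨min (k - 1) (n - 1), by lia⟩ with hf
  have hf0 : f 0 = 0 := by simp [hf]
  have hmono : Monotone f := by
    intro a b hab
    rcases Nat.eq_zero_or_pos a with rfl | ha
    · rw [hf0]; exact Nat.zero_le _
    · simp only [hf, if_neg ha.ne', if_neg (show b ≠ 0 by lia)]
      exact hh (Fin.mk_le_mk.2 (by lia))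
  refine ⟨fun j => f (j + 1) - f j, ?_, fun i h1 h2 => ?_⟩
  · rw [← prefixSum_of_le _ le_rfl, prefixSum_increments hmono hf0 le_rfl]
    simp only [hf, if_neg hn.ne']
    exact (Fin.isLt _).le
  · refine ⟨h ⟨i - 1, by lia⟩, ?_, ?_⟩
    · have := isSelectm_enumeration hh ⟨i - 1, by lia⟩
      rwa [Fin.val_mk, Nat.sub_add_cancel h1] at this
    · rw [prefixSum_increments hmono hf0 h2]
      simp only [hf, if_neg (show i ≠ 0 by lia), min_eq_left (show i - 1 ≤ n - 1 by lia)]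

end Succinct

open Succinct in
theorem mainTheorem7 :
    -- prefix sums
    (∃ (P : Program) (T : ℕ) (g : ℕ → ℝ),
      g =o[Filter.atTop] (fun n : ℕ => (n : ℝ)) ∧
      ∀ n m w : ℕ, m + n < 2 ^ w →
        ∃ S : ℕ, (S : ℝ) ≤ B n (m + n) + g n ∧
          ∀ x : Fin n → ℕ, ∑ j, x j ≤ m →
            ∃ bits : BitVec S, ∀ i : ℕ, 1 ≤ i → i ≤ n →
              Answers P T n m w bits i (prefixSum x i)) ∧
    -- multisets with select
    (∃ (P : Program) (T : ℕ) (g : ℕ → ℝ),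
      g =o[Filter.atTop] (fun n : ℕ => (n : ℝ)) ∧
      ∀ n m w : ℕ, m + n < 2 ^ w →
        ∃ S : ℕ, (S : ℝ) ≤ B n (m + n) + g n ∧
          ∀ M : Multiset (Fin m), M.card = n →
            ∃ bits : BitVec S, ∀ i : ℕ, 1 ≤ i → i ≤ n →
              ∃ v : Fin m, IsSelectm i M v ∧ Answers P T n m w bits i v) ∧
    -- optimality
    (∀ n m : ℕ,
      IsLeast {L : ℕ | EncodableInBits {x : Fin n → ℕ // ∑ j, x j ≤ m} L} (B n (m + n)) ∧
      (∀ L : ℕ, EncodableInBits {x : Fin n → ℕ // ∑ j, x j = m} L →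
        B n (m + n) ≤ L + ⌈Real.logb 2 (((m : ℝ) + n) / n)⌉₊) ∧
      (∀ L : ℕ, EncodableInBits {M : Multiset (Fin m) // M.card = n} L →
        B n (m + n) ≤ L + ⌈Real.logb 2 ((n : ℝ) + 1)⌉₊)) := by
  obtain ⟨K, h8, hK⟩ := exists_wordSize_bound
  refine ⟨⟨(Query.queryE K).program, (Query.queryE K).program.length,
      fun n => ((overhead n + K * 2 ^ K : ℕ) : ℝ), overhead_isLittleO _, ?_⟩,
    ⟨(Query.queryE K).program, (Query.queryE K).program.length,
      fun n => ((overhead n + K * 2 ^ K : ℕ) : ℝ), overhead_isLittleO _, ?_⟩,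
    fun n m => ⟨isLeast_encodable_bounded_sum n m, fun L => B_le_of_encodable_exact_sum,
      fun L => B_le_of_encodable_multiset⟩⟩
  · intro n m w hmn
    exact ⟨B n (m + n) + (overhead n + K * 2 ^ K), by push_cast; rfl,
      fun x hx => exists_bits h8 hK hmn x hx⟩
  · intro n m w hmn
    refine ⟨B n (m + n) + (overhead n + K * 2 ^ K), by push_cast; rfl, fun M hM => ?_⟩
    obtain ⟨x, hx, hsel⟩ := exists_sequence M hM
    obtain ⟨bits, hbits⟩ := exists_bits h8 hK hmn x hx
    refine ⟨bits, fun i h1 h2 => ?_⟩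
    obtain ⟨v, hv, hxv⟩ := hsel i h1 h2
    exact ⟨v, hv, hxv ▸ hbits i h1 h2⟩
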